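/- **Setting.** A fermionic chain has at each site a $d$-dimensional physical space, $d\ge 1$, whose basis vectors $n\in\{0,\dots,d-1\}$ have given parities $|n|\in\mathbb Z/2$. An *even tensor* $\mathcal A$ of bond dimension $D$ consists of matrices $A^n\in M_D(\mathbb C)$ and a diagonal parity operator $Z$ on $\mathbb C^D$ with diagonal entries $\pm1$, such that $ZA^n=(-1)^{|n|}A^nZ$ for all $n$. For $N\ge 1$ it generates the fermionic matrix product state (fMPS) with antiperiodic boundary conditions $$|V^{(N)}(\mathcal A)\rangle=\sum_{n_1,\dots,n_N}\operatorname{tr}(A^{n_1}\cdots A^{n_N})\,a_1^{\dagger n_1}\cdots a_N^{\dagger n_N}|\Omega\rangle .$$ Blocking $p\ge 1$ sites gives the even tensor $\mathcal A_p$ with physical index $I=(n_1,\dots,n_p)$, parity $|I|=|n_1|+\dots+|n_p|$, matrices $A^I=A^{n_1}\cdots A^{n_p}$ and the same $Z$. The transfer matrix of $\mathcal A$ is $E=\sum_n A^n\otimes\overline{A^n}$. A subspace $W\subseteq\mathbb C^D$ is *graded* if its orthogonal projector commutes with $Z$. An even tensor is a *graded normal tensor* if (i) no graded subspace other than $0$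 and $\mathbb C^D$ is invariant under all $A^n$; (ii) the spectral radius of $E$ is $1$, and $E$ has, counted with algebraic multiplicity, exactly one (non-degenerate case) or exactly two (degenerate case) eigenvalues of modulus $1$, all of them equal to $1$. An even tensor is in *graded canonical form* if, for some $r\ge 1$, $A^n=\bigoplus_{k=1}^r\mu_kA^n_k$ for all $n$ and $Z=\bigoplus_{k=1}^r Z_k$ with the same block structure, where $\mu_k\in\mathbb C$ and each $(A_k^n)_n$ with parity operator $Z_k$ is a graded normal tensor (degenerate or non-degenerate). **Theorem (existence of the graded canonical form).** For every even tensor $\mathcal A$ there are an integer $p\ge1$ and an even tensor $\mathcal A_{GCF}$ in graded canonical form, with the same physical space and parities as the blocked tensor $\mathcal A_p$, such that $|V^{(N)}(\mathcal A_{GCF})\rangle=|V^{(N)}(\mathcal A_p)\rangle$ for all $N\ge1$. -/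

import Mathlib

open scoped Kronecker

namespace FermionicMPS

/-- The sign `(-1)^a` of a parity `a ∈ ℤ/2`. -/
def paritySign (a : ZMod 2) : ℂ := (-1) ^ a.val

theorem paritySign_zero : paritySign 0 = 1 := by simp [paritySign]

theorem paritySign_add (a b : ZMod 2) : paritySign (a + b) = paritySign a * paritySign b := by
  rw [paritySign, paritySign, paritySign, ZMod.val_add, ← neg_one_pow_eq_pow_mod_two, pow_add]

/-- The parity operator `Z` on the auxiliary space `ℂ^ι` whose basis vector `i` has parity `q i`:
the diagonal matrix with entries `(-1)^{q i}`. -/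
def parityOperator {ι : Type*} [DecidableEq ι] (q : ι → ZMod 2) : Matrix ι ι ℂ :=
  Matrix.diagonal fun i => paritySign (q i)

/-- An even tensor `𝒜`. The physical basis is indexed by `σ`, the basis vector `n` having parity
`|n| = phys n`; the auxiliary space is `ℂ^ι`, graded by `parity`. It consists of matrices `A^n`
with `Z A^n = (-1)^{|n|} A^n Z`. -/
structure EvenTensor {σ : Type*} (phys : σ → ZMod 2) (ι : Type*) [Fintype ι] [DecidableEq ι] where
  /-- the matrices `A^n` -/
  mat : σ → Matrix ι ι ℂ
  /-- the parities of the basis vectors of the auxiliary space -/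
  parity : ι → ZMod 2
  /-- the commutation relation that makes the tensor even -/
  even : ∀ n, parityOperator parity * mat n =
    paritySign (phys n) • (mat n * parityOperator parity)

/-- The physical parity of a block of `p` sites: `|(n_1, …, n_p)| = |n_1| + ⋯ + |n_p|`. -/
def blockParity {σ : Type*} (phys : σ → ZMod 2) (p : ℕ) : (Fin p → σ) → ZMod 2 :=
  fun I => ∑ j, phys (I j)

/-- The ordered matrix product `A^{n_1} ⋯ A^{n_p}`. -/
def wordProd {σ ι : Type*} [Fintype ι] [DecidableEq ι] (A : σ → Matrix ι ι ℂ) {p : ℕ}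
    (I : Fin p → σ) : Matrix ι ι ℂ :=
  (List.ofFn fun j => A (I j)).prod

theorem wordProd_even {σ ι : Type*} [Fintype ι] [DecidableEq ι] {phys : σ → ZMod 2}
    (A : EvenTensor phys ι) (p : ℕ) (I : Fin p → σ) :
    parityOperator A.parity * wordProd A.mat I =
      paritySign (blockParity phys p I) • (wordProd A.mat I * parityOperator A.parity) := by
  induction p with
  | zero => simp [wordProd, blockParity, paritySign_zero]
  | succ p ih =>
    have h := ih (fun j => I j.succ)
    simp only [wordProd, blockParity, List.ofFn_succ, List.prod_cons, Fin.sum_univ_succ,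
      paritySign_add] at h ⊢
    rw [← Matrix.mul_assoc, A.even, Matrix.smul_mul, Matrix.mul_assoc, h, Matrix.mul_smul,
      smul_smul, Matrix.mul_assoc]

namespace EvenTensor

variable {σ ι : Type*} {phys : σ → ZMod 2} [Fintype ι] [DecidableEq ι]

/-- The blocked tensor `𝒜_p`: `p` neighbouring sites are grouped into one. Its matrices are
`A^{(n_1, …, n_p)} = A^{n_1} ⋯ A^{n_p}`, with the same auxiliary space and parity operator. -/
def block (A : EvenTensor phys ι) (p : ℕ) : EvenTensor (blockParity phys p) ι where
  mat := fun I => wordProd A.mat I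
  parity := A.parity
  even := wordProd_even A p

/-- The fermionic matrix product state with antiperiodic boundary conditions on `N` sites that `𝒜`
generates, written in the orthonormal Fock basis
`(a_1^†)^{n_1} ⋯ (a_N^†)^{n_N} |Ω⟩` of the chain, which is indexed by `(n_1, …, n_N)`.
Its coefficients are `tr (A^{n_1} ⋯ A^{n_N})`. -/
noncomputable def antiperiodicState (A : EvenTensor phys ι) (N : ℕ) :
    EuclideanSpace ℂ (Fin N → σ) :=
  WithLp.toLp 2 fun n => (wordProd A.mat n).trace

/-- The transfer matrix `E = ∑_n A^n ⊗ conj (A^n)`. -/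
noncomputable def transferMatrix [Fintype σ] (A : EvenTensor phys ι) :
    Matrix (ι × ι) (ι × ι) ℂ :=
  ∑ n, A.mat n ⊗ₖ (A.mat n).map (starRingEnd ℂ)

/-- A subspace `W` of the auxiliary space is graded if its orthogonal projector commutes with the
parity operator. -/
def IsGradedSubspace (A : EvenTensor phys ι) (W : Submodule ℂ (EuclideanSpace ℂ ι)) : Prop :=
  Commute W.starProjection (Matrix.toEuclideanCLM (𝕜 := ℂ) (parityOperator A.parity))

/-- A subspace `W` of the auxiliary space is left invariant by all the matrices `A^n`. -/
def IsInvariant (A : EvenTensor phys ι) (W : Submodule ℂ (EuclideanSpace ℂ ι)) : Prop :=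
  ∀ n, ∀ v ∈ W, Matrix.toEuclideanCLM (𝕜 := ℂ) (A.mat n) v ∈ W

/-- Graded irreducibility: no graded subspace other than `0` and the whole space is invariant. -/
def IsGradedIrreducible (A : EvenTensor phys ι) : Prop :=
  ∀ W : Submodule ℂ (EuclideanSpace ℂ ι),
    A.IsGradedSubspace W → A.IsInvariant W → W = ⊥ ∨ W = ⊤

/-- The eigenvalues of magnitude one of the transfer matrix, with algebraic multiplicity. -/
noncomputable def peripheralEigenvalues [Fintype σ] (A : EvenTensor phys ι) : Multiset ℂ :=
  open Classical in A.transferMatrix.charpoly.roots.filter fun z => ‖z‖ = 1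

/-- Non-degenerate graded normal tensor: graded irreducible, the spectral radius of the transfer
matrix is `1`, and exactly one eigenvalue has magnitude `1`; it is equal to `1`. -/
def IsNondegenerateGNT [Fintype σ] (A : EvenTensor phys ι) : Prop :=
  A.IsGradedIrreducible ∧ spectralRadius ℂ A.transferMatrix = 1 ∧
    A.peripheralEigenvalues = {1}

/-- Degenerate graded normal tensor: graded irreducible, the spectral radius of the transfer
matrix is `1`, and exactly two eigenvalues, counted with multiplicity, have magnitude `1`;
both are equal to `1`. -/
def IsDegenerateGNT [Fintype σ] (A : EvenTensor phys ι) : Prop :=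
  A.IsGradedIrreducible ∧ spectralRadius ℂ A.transferMatrix = 1 ∧
    A.peripheralEigenvalues = {1, 1}

/-- Graded normal tensors (degenerate or non-degenerate). -/
def IsGNT [Fintype σ] (A : EvenTensor phys ι) : Prop :=
  A.IsNondegenerateGNT ∨ A.IsDegenerateGNT

/-- Graded canonical form with `r` blocks of sizes `D 0, …, D (r - 1)`: the matrices are
`A^n = ⨁_k μ_k A_k^n`, each `𝒜_k` is a graded normal tensor (so that its transfer matrix has
spectral radius `1`), and the parity operator is the direct sum of those of the `𝒜_k`. -/
def IsGradedCanonicalForm [Fintype σ] {r : ℕ} {D : Fin r → ℕ}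
    (A : EvenTensor phys (Σ k : Fin r, Fin (D k))) : Prop :=
  ∃ (μ : Fin r → ℂ) (B : ∀ k : Fin r, EvenTensor phys (Fin (D k))),
    (∀ k, (B k).IsGNT) ∧
    (∀ n, A.mat n = Matrix.blockDiagonal' fun k => μ k • (B k).mat n) ∧
    parityOperator A.parity = Matrix.blockDiagonal' fun k => parityOperator (B k).parity

end EvenTensor

end FermionicMPS

/-! The proof is an induction on the bond dimension. Suppose that some blocking leaves a proper
nonzero graded subspace W invariant. In a basis of parity eigenvectors adapted to W ⊕ Wᗮ all its
matrices are block triangular, and traces of words see only the two diagonal blocks, which are even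
tensors of smaller dimension (`exists_split`). Otherwise every blocking is graded irreducible. Then
any blocking of an even number of sites is a multiple of a graded normal tensor
(`exists_isGNT_block`), unless all matrices vanish.

The second case is Perron–Frobenius theory for the channel Φ(X) = ∑ Aⁿ X (Aⁿ)ᴴ, which has the
characteristic polynomial of the transfer matrix. A Collatz–Wielandt argument on even positive
matrices gives an even positive definite ρ with Φ(ρ) = rρ (`exists_perron`), and rescaling makes r =
1. An eigenmatrix with eigenvalue |z| ≥ 1 then has the form Mρ with Aⁿ M = z M Aⁿ, and |z| = 1
(`intertwine_of_eigen`). The even and odd parts of M intertwine as well. If M ≠ 0 is even, it is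
invertible, so all powers of z are eigenvalues and z^q = 1 for some q > 0. Thus M commutes with
words of length q, and Schur's lemma for that blocking makes M scalar, whence z = 1. If M ≠ 0 is
odd, M² is even and z² = 1. Even blocking therefore moves every peripheral eigenvalue to 1. The
eigenvalue 1 has no Jordan blocks, and its eigenspace is spanned by ρ and at most one odd direction
Jρ. These are the non-degenerate and degenerate cases.

The induction statement covers all multiples of one block length, so that the summands of a
splitting can be brought to a common length before they are assembled into a direct sum. -/

open scoped ComplexOrder
open Matrix

namespace FermionicMPS

/-! ### Positivity of Hermitian matrices through real quadratic forms. -/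

section QuadraticForms

variable {ι : Type*}

theorem isHermitian_real_smul {X : Matrix ι ι ℂ} (hX : X.IsHermitian) (c : ℝ) :
    (c • X).IsHermitian := by
  rw [Matrix.IsHermitian, conjTranspose_smul, hX.eq, star_trivial]

theorem posSemidef_real_smul {X : Matrix ι ι ℂ} (hX : X.PosSemidef) {c : ℝ} (hc : 0 ≤ c) :
    (c • X).PosSemidef := hX.smul hc

variable [Fintype ι]

theorem posSemidef_of_re {X : Matrix ι ι ℂ} (hX : X.IsHermitian)
    (h : ∀ x : ι → ℂ, 0 ≤ (star x ⬝ᵥ X *ᵥ x).re) : X.PosSemidef :=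
  .of_dotProduct_mulVec_nonneg hX fun x =>
    Complex.nonneg_iff.2 ⟨h x, (hX.im_star_dotProduct_mulVec_self x).symm⟩

theorem posDef_of_re {X : Matrix ι ι ℂ} (hX : X.IsHermitian)
    (h : ∀ x : ι → ℂ, x ≠ 0 → 0 < (star x ⬝ᵥ X *ᵥ x).re) : X.PosDef :=
  .of_dotProduct_mulVec_pos hX fun x hx =>
    Complex.pos_iff.2 ⟨h x hx, (hX.im_star_dotProduct_mulVec_self x).symm⟩

theorem re_nonneg_of_posSemidef {X : Matrix ι ι ℂ} (hX : X.PosSemidef) (x : ι → ℂ) :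
    0 ≤ (star x ⬝ᵥ X *ᵥ x).re :=
  (Complex.nonneg_iff.1 (hX.dotProduct_mulVec_nonneg x)).1

theorem re_pos_of_posDef {X : Matrix ι ι ℂ} (hX : X.PosDef) {x : ι → ℂ} (hx : x ≠ 0) :
    0 < (star x ⬝ᵥ X *ᵥ x).re :=
  (Complex.pos_iff.1 (hX.dotProduct_mulVec_pos hx)).1

theorem mulVec_eq_zero_of_re {X : Matrix ι ι ℂ} (hX : X.PosSemidef) {x : ι → ℂ}
    (h : (star x ⬝ᵥ X *ᵥ x).re ≤ 0) : X *ᵥ x = 0 := by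
  classical
  refine (hX.dotProduct_mulVec_zero_iff x).1 ?_
  have h0 := hX.dotProduct_mulVec_nonneg x
  rw [Complex.nonneg_iff] at h0
  exact Complex.ext (le_antisymm h h0.1) h0.2.symm

theorem posDef_of_posSemidef {X : Matrix ι ι ℂ} (hX : X.PosSemidef)
    (h : ∀ x : ι → ℂ, X *ᵥ x = 0 → x = 0) : X.PosDef :=
  posDef_of_re hX.1 fun x hx => by
    by_contra h'
    exact hx (h x (mulVec_eq_zero_of_re hX (not_lt.1 h')))

theorem eq_zero_of_re {X : Matrix ι ι ℂ} (hX : X.IsHermitian)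
    (h : ∀ x : ι → ℂ, (star x ⬝ᵥ X *ᵥ x).re = 0) : X = 0 := by
  classical
  have hp := posSemidef_of_re hX fun x => (h x).ge
  ext i j
  have := congrFun (mulVec_eq_zero_of_re hp (x := Pi.single j 1) (h _).le) i
  simpa using this

theorem re_quadForm_smul (X : Matrix ι ι ℂ) (c : ℂ) (x : ι → ℂ) :
    (star (c • x) ⬝ᵥ X *ᵥ (c • x)).re = ‖c‖ ^ 2 * (star x ⬝ᵥ X *ᵥ x).re := by
  have : star (c • x) ⬝ᵥ X *ᵥ (c • x) = ((‖c‖ ^ 2 : ℝ) : ℂ) * (star x ⬝ᵥ X *ᵥ x) := by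
    rw [star_smul, mulVec_smul, smul_dotProduct, dotProduct_smul, smul_smul, smul_eq_mul,
      Complex.star_def, ← Complex.normSq_eq_conj_mul_self, Complex.normSq_eq_norm_sq]
  rw [this, Complex.re_ofReal_mul]

theorem re_quadForm_smul_left (X : Matrix ι ι ℂ) (c : ℝ) (x : ι → ℂ) :
    (star x ⬝ᵥ (c • X) *ᵥ x).re = c * (star x ⬝ᵥ X *ᵥ x).re := by
  rw [smul_mulVec, dotProduct_smul, Complex.smul_re, smul_eq_mul]

/-- On the compact unit sphere the form of P has a positive minimum and that of H is bounded above.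
This is the openness of the positive cone that every extremality argument below uses. -/
theorem exists_pos_posSemidef_sub_smul {P H : Matrix ι ι ℂ} (hP : P.PosDef)
    (hH : H.IsHermitian) : ∃ ε : ℝ, 0 < ε ∧ (P - ε • H).PosSemidef := by
  have hc (X : Matrix ι ι ℂ) : Continuous fun x : ι → ℂ => (star x ⬝ᵥ X *ᵥ x).re := by fun_prop
  have hS : IsCompact (Metric.sphere (0 : ι → ℂ) 1) := isCompact_sphere _ _
  suffices h : ∃ ε : ℝ, 0 < ε ∧ ∀ x ∈ Metric.sphere (0 : ι → ℂ) 1,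
      ε * (star x ⬝ᵥ H *ᵥ x).re ≤ (star x ⬝ᵥ P *ᵥ x).re by
    obtain ⟨ε, hε, h⟩ := h
    refine ⟨ε, hε, posSemidef_of_re (hP.1.sub (isHermitian_real_smul hH ε)) fun x => ?_⟩
    rw [sub_mulVec, dotProduct_sub, Complex.sub_re, re_quadForm_smul_left, sub_nonneg]
    rcases eq_or_ne x 0 with rfl | hx
    · simp
    have hn : ‖x‖ ≠ 0 := norm_ne_zero_iff.2 hx
    have h1 := h ((‖x‖⁻¹ : ℂ) • x) (by simp [norm_smul, hn])
    rw [re_quadForm_smul, re_quadForm_smul] at h1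
    have h2 : 0 < ‖(‖x‖⁻¹ : ℂ)‖ ^ 2 := by
      have : 0 < ‖x‖ := norm_pos_iff.2 hx
      simp; positivity
    nlinarith [h1, h2]
  rcases (Metric.sphere (0 : ι → ℂ) 1).eq_empty_or_nonempty with he | hne
  · exact ⟨1, one_pos, by simp [he]⟩
  obtain ⟨x₀, hx₀, hmin⟩ := hS.exists_isMinOn hne (hc P).continuousOn
  obtain ⟨x₁, hx₁, hmax⟩ := hS.exists_isMaxOn hne (hc H).continuousOn
  have ha : 0 < (star x₀ ⬝ᵥ P *ᵥ x₀).re := re_pos_of_posDef hP fun h => by simp [h] at hx₀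
  set a := (star x₀ ⬝ᵥ P *ᵥ x₀).re
  set b := (star x₁ ⬝ᵥ H *ᵥ x₁).re
  have hb : 0 < |b| + 1 := by positivity
  -- The denominator is |b| + 1 because the maximum b may be zero or negative.
  refine ⟨a / (|b| + 1), by positivity, fun x hx => ?_⟩
  have h1 : a ≤ (star x ⬝ᵥ P *ᵥ x).re := hmin hx
  have h2 : (star x ⬝ᵥ H *ᵥ x).re ≤ b := hmax hx
  refine le_trans ?_ h1
  calc a / (|b| + 1) * (star x ⬝ᵥ H *ᵥ x).re ≤ a / (|b| + 1) * (|b| + 1) := by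
        gcongr; linarith [le_abs_self b]
    _ = a := by field_simp

theorem isClosed_setOf_posSemidef : IsClosed {X : Matrix ι ι ℂ | X.PosSemidef} := by
  have : {X : Matrix ι ι ℂ | X.PosSemidef} =
      {X | Xᴴ = X} ∩ ⋂ x : ι → ℂ, {X | 0 ≤ (star x ⬝ᵥ X *ᵥ x).re} := by
    ext X
    simp only [Set.mem_ofPred_eq, Set.mem_inter_iff, Set.mem_iInter]
    exact ⟨fun h => ⟨h.1, re_nonneg_of_posSemidef h⟩, fun h => posSemidef_of_re h.1 h.2⟩
  rw [this]
  refine (isClosed_eq (by fun_prop) continuous_id).inter (isClosed_iInter fun x => ?_)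
  exact isClosed_le continuous_const (by fun_prop)

theorem eq_zero_of_posSemidef_add {X Y : Matrix ι ι ℂ} (hX : X.PosSemidef) (hY : Y.PosSemidef)
    (h : X + Y = 0) : X = 0 := by
  refine eq_zero_of_re hX.1 fun x => ?_
  have h1 := re_nonneg_of_posSemidef hX x
  have h2 := re_nonneg_of_posSemidef hY x
  have h3 : (star x ⬝ᵥ (X + Y) *ᵥ x).re = 0 := by simp [h]
  rw [add_mulVec, dotProduct_add, Complex.add_re] at h3
  linarith

end QuadraticForms

theorem star_dotProduct_mulVec_eq {ι : Type*} [Fintype ι] (M : Matrix ι ι ℂ) (x y : ι → ℂ) :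
    star x ⬝ᵥ M *ᵥ y = star (Mᴴ *ᵥ x) ⬝ᵥ y := by
  rw [star_mulVec, conjTranspose_conjTranspose, dotProduct_mulVec]

/-! ### The completely positive map of a tensor and graded irreducibility. -/

section Channel

variable {σ ι : Type*} [Fintype σ] [Fintype ι]

/-- The completely positive map `X ↦ ∑ₙ Aⁿ X (Aⁿ)ᴴ`. -/
def channel (A : σ → Matrix ι ι ℂ) : Matrix ι ι ℂ →ₗ[ℂ] Matrix ι ι ℂ where
  toFun X := ∑ n, A n * X * (A n)ᴴ
  map_add' X Y := by simp [mul_add, add_mul, Finset.sum_add_distrib]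
  map_smul' c X := by simp [Finset.smul_sum]

theorem channel_apply (A : σ → Matrix ι ι ℂ) (X : Matrix ι ι ℂ) :
    channel A X = ∑ n, A n * X * (A n)ᴴ := rfl

theorem channel_real_smul (A : σ → Matrix ι ι ℂ) (c : ℝ) (X : Matrix ι ι ℂ) :
    channel A (c • X) = c • channel A X := (channel A).map_smul_of_tower c X

theorem channel_conjTranspose (A : σ → Matrix ι ι ℂ) (X : Matrix ι ι ℂ) :
    channel A Xᴴ = (channel A X)ᴴ := by
  simp [channel_apply, conjTranspose_sum, mul_assoc]

theorem channel_posSemidef (A : σ → Matrix ι ι ℂ) {X : Matrix ι ι ℂ} (hX : X.PosSemidef) :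
    (channel A X).PosSemidef :=
  posSemidef_sum _ fun n _ => hX.mul_mul_conjTranspose_same (A n)

theorem quadForm_channel (A : σ → Matrix ι ι ℂ) (X : Matrix ι ι ℂ) (x : ι → ℂ) :
    star x ⬝ᵥ channel A X *ᵥ x = ∑ n, star ((A n)ᴴ *ᵥ x) ⬝ᵥ X *ᵥ ((A n)ᴴ *ᵥ x) := by
  rw [channel_apply, sum_mulVec, dotProduct_sum]
  refine Finset.sum_congr rfl fun n _ => ?_
  rw [star_mulVec, conjTranspose_conjTranspose, ← mulVec_mulVec, ← mulVec_mulVec,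
    dotProduct_mulVec (star x)]

theorem eq_zero_of_channel_eq_zero (A : σ → Matrix ι ι ℂ) {X : Matrix ι ι ℂ} (hX : X.PosDef)
    (h : channel A X = 0) (n : σ) : A n = 0 := by
  classical
  have key (x : ι → ℂ) : (A n)ᴴ *ᵥ x = 0 := by
    by_contra hx
    have h1 := congrArg Complex.re (quadForm_channel A X x)
    rw [h, Complex.re_sum] at h1
    have h2 := Finset.single_le_sum
      (fun n (_ : n ∈ Finset.univ) => re_nonneg_of_posSemidef hX.posSemidef ((A n)ᴴ *ᵥ x))
      (Finset.mem_univ n)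
    have h3 := re_pos_of_posDef hX hx
    simp only [zero_mulVec, dotProduct_zero, Complex.zero_re] at h1
    linarith
  rw [← conjTranspose_eq_zero]
  ext i j
  simpa using congrFun (key (Pi.single j 1)) i

/-- No subspace other than `0` and the whole space is invariant under `Z` and all `Aⁿ`. -/
def IsGradedIrred {σ : Type*} (Z : Matrix ι ι ℂ) (A : σ → Matrix ι ι ℂ) : Prop :=
  ∀ W : Submodule ℂ (ι → ℂ), (∀ v ∈ W, Z *ᵥ v ∈ W) → (∀ n, ∀ v ∈ W, A n *ᵥ v ∈ W) →
    W = ⊥ ∨ W = ⊤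

/-- The orthogonal complement of a subspace invariant under Z and the adjoints is invariant under Z
and the original matrices. -/
theorem IsGradedIrred.adjoint {σ : Type*} {Z : Matrix ι ι ℂ} {A : σ → Matrix ι ι ℂ}
    (hZ : Zᴴ = Z) (h : IsGradedIrred Z A) : IsGradedIrred Z fun n => (A n)ᴴ := by
  intro W hWZ hWA
  let e := WithLp.linearEquiv 2 ℂ (ι → ℂ)
  let U : Submodule ℂ (EuclideanSpace ℂ ι) := W.comap e.toLinearMap
  have hmem (v : ι → ℂ) : v ∈ Uᗮ.map e.toLinearMap ↔ ∀ w ∈ W, star w ⬝ᵥ v = 0 := by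
    rw [Submodule.mem_map_equiv, Submodule.mem_orthogonal]
    constructor
    · intro hv w hw
      have := hv (e.symm w) (by simpa [U] using hw)
      rwa [EuclideanSpace.inner_eq_star_dotProduct, dotProduct_comm] at this
    · intro hv u hu
      rw [EuclideanSpace.inner_eq_star_dotProduct, dotProduct_comm]
      exact hv _ hu
  have key := h (Uᗮ.map e.toLinearMap)
    (fun v hv => by
      rw [hmem] at hv ⊢
      intro w hw
      rw [star_dotProduct_mulVec_eq, hZ]
      exact hv _ (hWZ w hw))
    (fun n v hv => by
      rw [hmem] at hv ⊢
      intro w hw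
      rw [star_dotProduct_mulVec_eq]
      exact hv _ (hWA n w hw))
  rcases key with hb | ht
  · right
    have : Uᗮ = ⊥ := (Submodule.map_eq_bot_iff (e := e) (p := Uᗮ)).1 hb
    rw [Submodule.orthogonal_eq_bot_iff] at this
    rw [eq_top_iff]
    intro v _
    have hv : e.symm v ∈ U := this ▸ Submodule.mem_top
    simpa [U] using hv
  · left
    rw [eq_bot_iff]
    intro w hw
    have := (hmem w).1 (ht ▸ Submodule.mem_top) w hw
    exact dotProduct_star_self_eq_zero.1 this

variable [DecidableEq ι]

/-- `Z` is a self-adjoint involution with which each `Aⁿ` commutes up to a phase. -/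
structure IsGraded (Z : Matrix ι ι ℂ) (A : σ → Matrix ι ι ℂ) : Prop where
  herm : Zᴴ = Z
  sq : Z * Z = 1
  comm : ∀ n, ∃ s : ℂ, star s = s ∧ s * s = 1 ∧ Z * A n = s • (A n * Z)

/-- Each Aⁿ occurs once together with its adjoint, so the sign from moving Z through it appears
squared. -/
theorem IsGraded.channel_conj {Z : Matrix ι ι ℂ} {A : σ → Matrix ι ι ℂ} (h : IsGraded Z A)
    (X : Matrix ι ι ℂ) : channel A (Z * X * Z) = Z * channel A X * Z := by
  rw [channel_apply, channel_apply, Finset.mul_sum, Finset.sum_mul]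
  refine Finset.sum_congr rfl fun n _ => ?_
  obtain ⟨s, hs', hs, hc⟩ := h.comm n
  have h2 : (A n)ᴴ * Z = s • (Z * (A n)ᴴ) := by
    have := congrArg conjTranspose hc
    rwa [conjTranspose_mul, conjTranspose_smul, hs', conjTranspose_mul, h.herm] at this
  calc A n * (Z * X * Z) * (A n)ᴴ = (A n * Z) * X * (Z * (A n)ᴴ) := by simp only [mul_assoc]
    _ = (s * s) • ((A n * Z) * X * (Z * (A n)ᴴ)) := by rw [hs, one_smul]
    _ = (s • (A n * Z)) * X * (s • (Z * (A n)ᴴ)) := by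
        simp only [smul_mul_assoc, mul_smul_comm, smul_smul]
    _ = Z * (A n * X * (A n)ᴴ) * Z := by rw [← hc, ← h2]; simp only [mul_assoc]

/-- On ker F the form of Φ(F) is a sum of nonnegative terms ⟨(Aⁿ)ᴴx, F (Aⁿ)ᴴx⟩. The hypothesis `hk`
makes them all vanish, so ker F is invariant under Z and all (Aⁿ)ᴴ, hence trivial or everything. -/
theorem IsGradedIrred.eq_zero_or_posDef {Z : Matrix ι ι ℂ} {A : σ → Matrix ι ι ℂ}
    (hZ : Zᴴ = Z) (h : IsGradedIrred Z A) {F : Matrix ι ι ℂ} (hF : F.PosSemidef)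
    (hc : Z * F = F * Z)
    (hk : ∀ x, F *ᵥ x = 0 → (star x ⬝ᵥ channel A F *ᵥ x).re ≤ 0) : F = 0 ∨ F.PosDef := by
  have hmem (x : ι → ℂ) : x ∈ LinearMap.ker F.mulVecLin ↔ F *ᵥ x = 0 := by simp
  rcases h.adjoint hZ (LinearMap.ker F.mulVecLin)
    (fun v hv => by
      rw [hmem] at hv ⊢
      rw [mulVec_mulVec, ← hc, ← mulVec_mulVec, hv, mulVec_zero])
    (fun n v hv => by
      rw [hmem] at hv ⊢
      have h0 := hk v hv
      rw [quadForm_channel, Complex.re_sum] at h0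
      have hnn := fun n (_ : n ∈ Finset.univ) => re_nonneg_of_posSemidef hF ((A n)ᴴ *ᵥ v)
      exact mulVec_eq_zero_of_re hF
        ((Finset.single_le_sum hnn (Finset.mem_univ n)).trans h0)) with hb | ht
  · right
    refine posDef_of_posSemidef hF fun x hx => ?_
    have : x ∈ LinearMap.ker F.mulVecLin := (hmem x).2 hx
    rwa [hb] at this
  · left
    have := LinearMap.ker_eq_top.1 ht
    ext i j
    simpa using congrFun (LinearMap.congr_fun this (Pi.single j 1)) i

/-- A superharmonic even positive matrix vanishes or is positive definite. -/
theorem IsGradedIrred.posDef_of_superharmonic {Z : Matrix ι ι ℂ} {A : σ → Matrix ι ι ℂ}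
    (hZ : Zᴴ = Z) (h : IsGradedIrred Z A) {F : Matrix ι ι ℂ} (hF : F.PosSemidef)
    (hc : Z * F = F * Z) {r : ℝ} (hr : (r • F - channel A F).PosSemidef) :
    F = 0 ∨ F.PosDef := by
  refine h.eq_zero_or_posDef hZ hF hc fun x hx => ?_
  have := re_nonneg_of_posSemidef hr x
  rw [sub_mulVec, dotProduct_sub, smul_mulVec, hx] at this
  simpa using this

theorem IsGraded.channel_comm {Z : Matrix ι ι ℂ} {A : σ → Matrix ι ι ℂ} (h : IsGraded Z A)
    {X : Matrix ι ι ℂ} (hX : Z * X = X * Z) : Z * channel A X = channel A X * Z := by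
  have h1 : Z * X * Z = X := by rw [hX, mul_assoc, h.sq, mul_one]
  have h2 := h.channel_conj X
  rw [h1] at h2
  conv_rhs => rw [h2]
  rw [mul_assoc, h.sq, mul_one]

/-- Finitely many applications of `1 + Φ` make a nonzero even positive matrix positive definite. -/
theorem IsGradedIrred.exists_pow_posDef {Z : Matrix ι ι ℂ} {A : σ → Matrix ι ι ℂ}
    (hg : IsGraded Z A) (h : IsGradedIrred Z A) {P : Matrix ι ι ℂ} (hP : P.PosSemidef)
    (hc : Z * P = P * Z) (h0 : P ≠ 0) : ∃ m : ℕ, (((1 + channel A) ^ m) P).PosDef := by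
  induction hk : Module.finrank ℂ (LinearMap.ker P.mulVecLin) using Nat.strong_induction_on
    generalizing P with
  | _ k ih =>
    by_cases hd : P.PosDef
    · exact ⟨0, by simpa using hd⟩
    have hΦ := channel_posSemidef A hP
    have hP' : (P + channel A P).PosSemidef := hP.add hΦ
    have hsum (x : ι → ℂ) (hx : (P + channel A P) *ᵥ x = 0) :
        (star x ⬝ᵥ P *ᵥ x).re + (star x ⬝ᵥ channel A P *ᵥ x).re = 0 := by
      rw [← Complex.add_re, ← dotProduct_add, ← add_mulVec, hx]; simp
    have hle : LinearMap.ker (P + channel A P).mulVecLin ≤ LinearMap.ker P.mulVecLin := by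
      intro x hx
      rw [LinearMap.mem_ker, mulVecLin_apply] at hx ⊢
      have h1 := hsum x hx
      have h2 := re_nonneg_of_posSemidef hΦ x
      exact mulVec_eq_zero_of_re hP (by linarith)
    -- The kernel can only shrink. If it did not shrink strictly, the form of Φ(P) would vanish on
    -- ker P and irreducibility would already make P zero or positive definite.
    have hne : LinearMap.ker (P + channel A P).mulVecLin ≠ LinearMap.ker P.mulVecLin := by
      intro he
      refine (h.eq_zero_or_posDef hg.herm hP hc fun x hx => ?_).elim h0 hd
      have hx' : x ∈ LinearMap.ker (P + channel A P).mulVecLin := by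
        rw [he]; simpa using hx
      have h1 := hsum x (LinearMap.mem_ker.1 hx')
      have h2 := re_nonneg_of_posSemidef hP x
      linarith
    obtain ⟨m, hm⟩ := ih _ (hk ▸ Submodule.finrank_lt_finrank_of_lt (lt_of_le_of_ne hle hne)) hP'
      (by rw [mul_add, add_mul, hc, hg.channel_comm hc])
      (fun hz => h0 (eq_zero_of_posSemidef_add hP hΦ hz)) rfl
    exact ⟨m + 1, by simpa [pow_succ, Module.End.mul_apply] using hm⟩

end Channel

/-! ### Existence of a Perron eigenmatrix. -/

section Existence

variable {σ ι : Type*} [Fintype σ] [Fintype ι]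

attribute [local instance] Matrix.normedAddCommGroup Matrix.normedSpace

theorem re_trace_pos {X : Matrix ι ι ℂ} (hX : X.PosSemidef) (h0 : X ≠ 0) : 0 < X.trace.re := by
  have h1 := Complex.nonneg_iff.1 hX.trace_nonneg
  refine lt_of_le_of_ne h1.1 fun h => h0 ?_
  exact hX.trace_eq_zero_iff.1 (Complex.ext h.symm h1.2.symm)

theorem channel_pow_comm (A : σ → Matrix ι ι ℂ) (m : ℕ) (X : Matrix ι ι ℂ) :
    channel A (((1 + channel A) ^ m) X) = ((1 + channel A) ^ m) (channel A X) := by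
  have : Commute (channel A) ((1 + channel A) ^ m) :=
    ((Commute.one_right _).add_right (Commute.refl _)).pow_right m
  exact LinearMap.congr_fun this.eq X

theorem posSemidef_pow_channel (A : σ → Matrix ι ι ℂ) (m : ℕ) {X : Matrix ι ι ℂ}
    (hX : X.PosSemidef) : (((1 + channel A) ^ m) X).PosSemidef := by
  induction m with
  | zero => simpa
  | succ m ih =>
    rw [pow_succ', Module.End.mul_apply]
    exact ih.add (channel_posSemidef A ih)

variable [DecidableEq ι]

/-- The largest `t` with `Φ(X) ≥ t X` for some nonzero even positive `X` (Collatz–Wielandt). -/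
theorem exists_collatzWielandt [Nonempty ι] (Z : Matrix ι ι ℂ) (A : σ → Matrix ι ι ℂ) :
    ∃ (r : ℝ) (X : Matrix ι ι ℂ), 0 ≤ r ∧ X.PosSemidef ∧ Z * X = X * Z ∧ X ≠ 0 ∧
      (channel A X - r • X).PosSemidef ∧
      ∀ (t : ℝ) (Y : Matrix ι ι ℂ), 0 ≤ t → Y.PosSemidef → Z * Y = Y * Z → Y ≠ 0 →
        (channel A Y - t • Y).PosSemidef → t ≤ r := by
  let K : Set (Matrix ι ι ℂ) := Metric.sphere 0 1 ∩ ({X | X.PosSemidef} ∩ {X | Z * X = X * Z})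
  have : ProperSpace (Matrix ι ι ℂ) := FiniteDimensional.proper ℂ _
  have hK : IsCompact K := (isCompact_sphere _ _).inter_right
    (isClosed_setOf_posSemidef.inter (isClosed_eq (by fun_prop) (by fun_prop)))
  have hΦ : Continuous (channel A) := (channel A).continuous_of_finiteDimensional
  have hK0 {X : Matrix ι ι ℂ} (hX : X ∈ K) : X ≠ 0 := by
    rintro rfl; simpa using hX.1
  have hnorm {Y : Matrix ι ι ℂ} (hY : Y.PosSemidef) (hc : Z * Y = Y * Z) (h0 : Y ≠ 0) :
      ‖Y‖⁻¹ • Y ∈ K := by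
    refine ⟨?_, posSemidef_real_smul hY (by positivity), ?_⟩
    · simp [norm_smul, norm_ne_zero_iff.2 h0]
    · simp [hc]
  have hKne : K.Nonempty := ⟨_, hnorm PosSemidef.one (by simp) one_ne_zero⟩
  obtain ⟨X₀, hX₀, hmin⟩ := hK.exists_isMinOn (f := fun X => X.trace.re) hKne
    (by fun_prop)
  obtain ⟨X₁, hX₁, hmax⟩ := hK.exists_isMaxOn (f := fun X => (channel A X).trace.re) hKne
    (by fun_prop)
  have ha : 0 < X₀.trace.re := re_trace_pos hX₀.2.1 (hK0 hX₀)
  -- Taking traces in Φ(X) ≥ tX bounds t uniformly over the normalized matrices, so admissible pairs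
  -- (t, X) form a compact set.
  set C := (channel A X₁).trace.re / X₀.trace.re
  have hbound (t : ℝ) (ht : 0 ≤ t) (X) (hX : X ∈ K) (h : (channel A X - t • X).PosSemidef) :
      t ≤ C := by
    have h1 := (Complex.nonneg_iff.1 h.trace_nonneg).1
    rw [trace_sub, trace_smul, Complex.sub_re, Complex.smul_re, smul_eq_mul] at h1
    have h2 : X₀.trace.re ≤ X.trace.re := hmin hX
    have h3 : (channel A X).trace.re ≤ (channel A X₁).trace.re := hmax hX
    rw [le_div_iff₀ ha]
    nlinarith [mul_le_mul_of_nonneg_left h2 ht]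
  let S : Set (ℝ × Matrix ι ι ℂ) :=
    (Set.Icc 0 C ×ˢ K) ∩ (fun p => channel A p.2 - p.1 • p.2) ⁻¹' {X | X.PosSemidef}
  have hS : IsCompact S := (isCompact_Icc.prod hK).inter_right
    (isClosed_setOf_posSemidef.preimage (by fun_prop))
  have hmemS (t : ℝ) (ht : 0 ≤ t) (X) (hX : X ∈ K) (h : (channel A X - t • X).PosSemidef) :
      (t, X) ∈ S := ⟨⟨⟨ht, hbound t ht X hX h⟩, hX⟩, h⟩
  have hSne : S.Nonempty := by
    obtain ⟨X, hX⟩ := hKne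
    exact ⟨_, hmemS 0 le_rfl X hX (by simpa using channel_posSemidef A hX.2.1)⟩
  obtain ⟨⟨r, X⟩, hrX, hmaxr⟩ := hS.exists_isMaxOn (f := Prod.fst) hSne continuous_fst.continuousOn
  refine ⟨r, X, hrX.1.1.1, hrX.1.2.2.1, hrX.1.2.2.2, hK0 hrX.1.2, hrX.2, ?_⟩
  intro t Y ht hY hc h0 h
  have := posSemidef_real_smul h (inv_nonneg.2 (norm_nonneg Y))
  refine hmaxr (hmemS t ht (‖Y‖⁻¹ • Y) (hnorm hY hc h0) ?_)
  rwa [channel_real_smul, smul_comm t, ← smul_sub]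

theorem IsGraded.pow_channel_comm {Z : Matrix ι ι ℂ} {A : σ → Matrix ι ι ℂ} (h : IsGraded Z A)
    (m : ℕ) {X : Matrix ι ι ℂ} (hX : Z * X = X * Z) :
    Z * ((1 + channel A) ^ m) X = ((1 + channel A) ^ m) X * Z := by
  induction m with
  | zero => simpa
  | succ m ih =>
    rw [pow_succ', Module.End.mul_apply, LinearMap.add_apply, mul_add, add_mul,
      Module.End.one_apply, ih, h.channel_comm ih]

/-- Perron–Frobenius: a graded irreducible nonzero family has a positive definite even
eigenmatrix with positive eigenvalue. -/
theorem IsGradedIrred.exists_perron {Z : Matrix ι ι ℂ} {A : σ → Matrix ι ι ℂ}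
    (hg : IsGraded Z A) (h : IsGradedIrred Z A) (hA : ∃ n, A n ≠ 0) :
    ∃ (r : ℝ) (ρ : Matrix ι ι ℂ), 0 < r ∧ ρ.PosDef ∧ Z * ρ = ρ * Z ∧ channel A ρ = r • ρ := by
  obtain ⟨n₀, hn₀⟩ := hA
  have : Nonempty ι := by
    by_contra hne
    rw [not_nonempty_iff] at hne
    exact hn₀ (Subsingleton.elim _ _)
  obtain ⟨r, X, hr, hX, hXc, hX0, hXr, hmax⟩ := exists_collatzWielandt Z A
  -- Otherwise a power of 1 + Φ turns the defect into a positive definite one. It commutes with Φ,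
  -- so the image Y of X satisfies Φ(Y) ≥ (r + ε)Y, against the maximality of r.
  have hfix : channel A X - r • X = 0 := by
    by_contra hne
    have hPc : Z * (channel A X - r • X) = (channel A X - r • X) * Z := by
      rw [mul_sub, sub_mul, hg.channel_comm hXc, mul_smul_comm, hXc, smul_mul_assoc]
    obtain ⟨m, hm⟩ := h.exists_pow_posDef hg hXr hPc hne
    set Y := ((1 + channel A) ^ m) X
    have hY : Y.PosSemidef := posSemidef_pow_channel A m hX
    have hYm : (channel A Y - r • Y).PosDef := by
      rw [map_sub, LinearMap.map_smul_of_tower, ← channel_pow_comm] at hm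
      exact hm
    have hY0 : Y ≠ 0 := by
      intro h0
      rw [h0] at hYm
      simp only [map_zero, smul_zero, sub_zero] at hYm
      exact lt_irrefl (0 : ℂ) (by simpa using hYm.trace_pos)
    obtain ⟨ε, hε, hYε⟩ := exists_pos_posSemidef_sub_smul hYm hY.1
    rw [sub_sub, ← add_smul] at hYε
    have := hmax (r + ε) Y (by linarith) hY (hg.pow_channel_comm m hXc) hY0 hYε
    linarith
  have hfix' : channel A X = r • X := sub_eq_zero.1 hfix
  have hpd : X.PosDef := (h.posDef_of_superharmonic hg.herm hX hXc (r := r)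
    (by rw [hfix', sub_self]; exact .zero)).resolve_left hX0
  -- If r were 0, Φ would kill a positive definite matrix, and then every Aⁿ would be zero.
  refine ⟨r, X, lt_of_le_of_ne hr fun hr0 => hn₀ ?_, hpd, hXc, hfix'⟩
  rw [← hr0, zero_smul] at hfix'
  exact eq_zero_of_channel_eq_zero A hpd hfix' n₀

end Existence

/-! ### Semisimplicity of the eigenvalue 1. -/

section Drift

variable {σ ι : Type*} [Fintype σ] [Fintype ι] {A : σ → Matrix ι ι ℂ} {ρ : Matrix ι ι ℂ}

/-- Since ρ dominates εY, iterating the positive map Φ shows that ρ dominates ε(Y + kV) for all k.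
Linear growth in k is incompatible with a fixed bound unless V ≤ 0. -/
theorem channel_fixed_drift_nonpos (hρ : ρ.PosDef) (hfix : channel A ρ = ρ)
    {Y V : Matrix ι ι ℂ} (hY : Y.IsHermitian) (hYV : channel A Y = Y + V)
    (hV : channel A V = V) (x : ι → ℂ) : (star x ⬝ᵥ V *ᵥ x).re ≤ 0 := by
  obtain ⟨ε, hε, hle⟩ := exists_pos_posSemidef_sub_smul hρ hY
  have hk (k : ℕ) : (ρ - ε • (Y + (k : ℝ) • V)).PosSemidef := by
    induction k with
    | zero => simpa using hle
    | succ k ih =>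
      have := channel_posSemidef A ih
      rw [map_sub, channel_real_smul, map_add, channel_real_smul, hYV, hV, hfix] at this
      convert this using 3
      push_cast
      rw [add_smul, one_smul]; abel
  by_contra! hpos
  set v := (star x ⬝ᵥ V *ᵥ x).re
  obtain ⟨k, hk'⟩ := exists_nat_gt (((star x ⬝ᵥ ρ *ᵥ x).re / ε - (star x ⬝ᵥ Y *ᵥ x).re) / v)
  have h1 := re_nonneg_of_posSemidef (hk k) x
  rw [sub_mulVec, dotProduct_sub, Complex.sub_re, re_quadForm_smul_left, add_mulVec,
    dotProduct_add, Complex.add_re, re_quadForm_smul_left] at h1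
  rw [div_lt_iff₀ hpos, sub_lt_iff_lt_add, div_lt_iff₀ hε] at hk'
  nlinarith

/-- For Hermitian Y and V the drift bound applies to both signs and forces V = 0. The general case
splits into Hermitian parts, with the anti-Hermitian part reached by multiplying by i. -/
theorem channel_fixed_no_jordan (hρ : ρ.PosDef) (hfix : channel A ρ = ρ)
    {Y V : Matrix ι ι ℂ} (hYV : channel A Y = Y + V) (hV : channel A V = V) : V = 0 := by
  have key {Y V : Matrix ι ι ℂ} (hY : Y.IsHermitian) (hVh : V.IsHermitian)
      (hYV : channel A Y = Y + V) (hV : channel A V = V) : V = 0 := by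
    refine eq_zero_of_re hVh fun x => le_antisymm
      (channel_fixed_drift_nonpos hρ hfix hY hYV hV x) ?_
    have := channel_fixed_drift_nonpos hρ hfix (Y := -Y) (V := -V) hY.neg
      (by rw [map_neg, hYV, neg_add]) (by rw [map_neg, hV]) x
    rw [neg_mulVec, dotProduct_neg, Complex.neg_re] at this
    linarith
  have real {Y V : Matrix ι ι ℂ} (hYV : channel A Y = Y + V) (hV : channel A V = V) :
      V + Vᴴ = 0 := by
    refine key (Y := Y + Yᴴ) (isHermitian_add_transpose_self Y)
      (isHermitian_add_transpose_self V) ?_ ?_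
    · rw [map_add, channel_conjTranspose, hYV, conjTranspose_add]; abel
    · rw [map_add, channel_conjTranspose, hV]
  have h1 := real hYV hV
  have h2 := real (Y := Complex.I • Y) (V := Complex.I • V) (by rw [map_smul, hYV, smul_add])
    (by rw [map_smul, hV])
  rw [conjTranspose_smul, Complex.star_def, Complex.conj_I, neg_smul, ← sub_eq_add_neg,
    ← smul_sub, smul_eq_zero] at h2
  have h3 : V - Vᴴ = 0 := h2.resolve_left Complex.I_ne_zero
  have h4 : (2 : ℂ) • V = 0 := by
    calc (2 : ℂ) • V = (V + Vᴴ) + (V - Vᴴ) := by rw [two_smul]; abel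
      _ = 0 := by rw [h1, h3, add_zero]
  exact (smul_eq_zero.1 h4).resolve_left two_ne_zero

theorem maxGenEigenspace_channel_one (hρ : ρ.PosDef) (hfix : channel A ρ = ρ) :
    Module.End.maxGenEigenspace (channel A) 1 = Module.End.eigenspace (channel A) 1 := by
  refine le_antisymm (fun Y hY => ?_) (Module.End.eigenspace_le_maxGenEigenspace ..)
  rw [Module.End.mem_maxGenEigenspace] at hY
  obtain ⟨k, hk⟩ := hY
  rw [one_smul] at hk
  rw [Module.End.mem_eigenspace_iff, one_smul]
  induction k generalizing Y with
  | zero => rw [pow_zero, Module.End.one_apply] at hk; simp [hk]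
  | succ k ih =>
    rw [pow_succ, Module.End.mul_apply] at hk
    have h1 := ih _ hk
    have := channel_fixed_no_jordan hρ hfix (Y := Y) (V := (channel A - 1) Y)
      (by simp) h1
    exact sub_eq_zero.1 (by simpa using this)

end Drift

/-! ### Even and odd parts under conjugation by Z. -/

section Parts

variable {σ ι : Type*} [Fintype ι] [DecidableEq ι] {Z : Matrix ι ι ℂ} {A : σ → Matrix ι ι ℂ}

theorem IsGraded.conj_posSemidef (hg : IsGraded Z A) {X : Matrix ι ι ℂ} (hX : X.PosSemidef) :
    (Z * X * Z).PosSemidef := by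
  have := hX.mul_mul_conjTranspose_same Z
  rwa [hg.herm] at this

theorem IsGraded.even_part (hg : IsGraded Z A) (X : Matrix ι ι ℂ) :
    Z * (X + Z * X * Z) = (X + Z * X * Z) * Z := by
  simp only [mul_add, add_mul, mul_assoc, hg.sq, mul_one]
  simp only [← mul_assoc, hg.sq, one_mul]
  rw [add_comm]

theorem IsGraded.odd_part (hg : IsGraded Z A) (X : Matrix ι ι ℂ) :
    Z * (X - Z * X * Z) = (-1 : ℂ) • ((X - Z * X * Z) * Z) := by
  simp only [mul_sub, sub_mul, mul_assoc, hg.sq, mul_one]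
  simp only [← mul_assoc, hg.sq, one_mul]
  simp

end Parts

/-! ### Rigidity of subharmonic matrices and peripheral eigenmatrices. -/

section FixedPoint

variable {σ ι : Type*} [Fintype σ] [Fintype ι] [DecidableEq ι]
  {Z : Matrix ι ι ℂ} {A : σ → Matrix ι ι ℂ} {ρ : Matrix ι ι ℂ}

/-- For the largest c with ρ ≥ cQ, the matrix ρ - cQ is superharmonic, hence zero or positive
definite. Positive definiteness would let c grow, so Q is a multiple of the fixed point ρ. -/
theorem IsGradedIrred.channel_eq_of_even_subharmonic (hg : IsGraded Z A) (h : IsGradedIrred Z A)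
    (hρ : ρ.PosDef) (hρc : Z * ρ = ρ * Z) (hfix : channel A ρ = ρ) {Q : Matrix ι ι ℂ}
    (hQ : Q.PosSemidef) (hQc : Z * Q = Q * Z) (hs : (channel A Q - Q).PosSemidef) :
    channel A Q = Q := by
  rcases eq_or_ne Q 0 with rfl | hQ0
  · simp
  have hQt := re_trace_pos hQ hQ0
  let S : Set ℝ := {c | 0 ≤ c} ∩ (fun c : ℝ => ρ - c • Q) ⁻¹' {X | X.PosSemidef}
  have hSc : IsClosed S := (isClosed_le continuous_const continuous_id).inter
    (isClosed_setOf_posSemidef.preimage (by fun_prop))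
  have hSb : S ⊆ Set.Icc 0 (ρ.trace.re / Q.trace.re) := by
    intro c hc
    refine ⟨hc.1, ?_⟩
    have h1 := (Complex.nonneg_iff.1 (PosSemidef.trace_nonneg hc.2)).1
    rw [trace_sub, trace_smul, Complex.sub_re, Complex.smul_re, smul_eq_mul] at h1
    rw [le_div_iff₀ hQt]
    linarith
  have hS0 : S.Nonempty := ⟨0, le_refl (0 : ℝ), by simpa using hρ.posSemidef⟩
  obtain ⟨c, hc, hmax⟩ := (isCompact_Icc.of_isClosed_subset hSc hSb).exists_isMaxOn hS0
    continuous_id.continuousOn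
  have hF : (ρ - c • Q).PosSemidef := hc.2
  have hF' : (1 : ℝ) • (ρ - c • Q) - channel A (ρ - c • Q) = c • (channel A Q - Q) := by
    rw [map_sub, channel_real_smul, hfix, one_smul, smul_sub]; abel
  rcases h.posDef_of_superharmonic hg.herm hF
    (by rw [mul_sub, sub_mul, hρc, mul_smul_comm, hQc, smul_mul_assoc]) (r := 1)
    (by rw [hF']; exact posSemidef_real_smul hs hc.1) with h0 | hpd
  · have hcρ : c • Q = ρ := (sub_eq_zero.1 h0).symm
    have hc0 : c ≠ 0 := by
      rintro rfl
      rw [zero_smul] at hcρ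
      have hz : ∀ x : ι → ℂ, x = 0 := fun x => by
        by_contra hx
        simpa [← hcρ] using re_pos_of_posDef hρ hx
      refine hQ0 (Matrix.ext fun i j => ?_)
      simpa using congrFun (hz fun _ => 1) i
    have : c • channel A Q = c • Q := by rw [← channel_real_smul, hcρ, hfix]
    exact smul_right_injective _ hc0 this
  · obtain ⟨ε, hε, hle⟩ := exists_pos_posSemidef_sub_smul hpd hQ.1
    rw [sub_sub, ← add_smul] at hle
    have : c + ε ≤ c := hmax (show c + ε ∈ S from ⟨add_nonneg hc.1 hε.le, hle⟩)
    linarith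

/-- A subharmonic positive matrix is harmonic. -/
theorem IsGradedIrred.channel_eq_of_subharmonic (hg : IsGraded Z A) (h : IsGradedIrred Z A)
    (hρ : ρ.PosDef) (hρc : Z * ρ = ρ * Z) (hfix : channel A ρ = ρ) {Q : Matrix ι ι ℂ}
    (hQ : Q.PosSemidef) (hs : (channel A Q - Q).PosSemidef) : channel A Q - Q = 0 := by
  have hs' := hg.conj_posSemidef hs
  -- Symmetrizing by Z reduces to even Q. The symmetrized defect is a sum of two positive matrices,
  -- so its vanishing kills each of them.
  have he : channel A (Q + Z * Q * Z) - (Q + Z * Q * Z) =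
      (channel A Q - Q) + Z * (channel A Q - Q) * Z := by
    rw [map_add, hg.channel_conj, mul_sub, sub_mul]; abel
  have := h.channel_eq_of_even_subharmonic hg hρ hρc hfix (hQ.add (hg.conj_posSemidef hQ))
    (hg.even_part Q) (by rw [he]; exact hs.add hs')
  rw [← sub_eq_zero, he] at this
  exact eq_zero_of_posSemidef_add hs hs' this

/-- Eigenmatrices of modulus at least one come from twisted intertwiners. -/
theorem IsGradedIrred.intertwine_of_eigen (hg : IsGraded Z A) (h : IsGradedIrred Z A)
    (hρ : ρ.PosDef) (hρc : Z * ρ = ρ * Z) (hfix : channel A ρ = ρ) {M : Matrix ι ι ℂ} {z : ℂ}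
    (hM : M ≠ 0) (hz : 1 ≤ ‖z‖) (he : channel A (M * ρ) = z • (M * ρ)) :
    ‖z‖ = 1 ∧ ∀ n, A n * M = z • (M * A n) := by
  set Q := M * ρ * Mᴴ with hQdef
  have hQ : Q.PosSemidef := hρ.posSemidef.mul_mul_conjTranspose_same M
  have he' : channel A (ρ * Mᴴ) = star z • (ρ * Mᴴ) := by
    have := congrArg conjTranspose he
    rwa [← channel_conjTranspose, conjTranspose_smul, conjTranspose_mul, hρ.1.eq] at this
  -- The failure to intertwine, measured by the positive matrix ∑ Dₙ ρ Dₙᴴ. The eigenvalue equation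
  -- and its adjoint evaluate the cross terms, which leaves Φ(Q) - |z|²Q. As |z| ≥ 1, Q is
  -- subharmonic, so both this sum and (|z|² - 1)Q vanish.
  have hD : channel (fun n => A n * M - z • (M * A n)) ρ = channel A Q - (‖z‖ ^ 2) • Q := by
    have h1 : channel (fun n => A n * M - z • (M * A n)) ρ =
        channel A Q - star z • (channel A (M * ρ) * Mᴴ) - z • (M * channel A (ρ * Mᴴ))
          + (z * star z) • (M * channel A ρ * Mᴴ) := by
      simp only [channel_apply, Finset.sum_mul, Finset.mul_sum, Finset.smul_sum, hQdef,
        ← Finset.sum_sub_distrib, ← Finset.sum_add_distrib]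
      refine Finset.sum_congr rfl fun n _ => ?_
      simp only [conjTranspose_sub, conjTranspose_smul, conjTranspose_mul, sub_mul, mul_sub,
        smul_mul_assoc, mul_smul_comm, smul_smul, mul_assoc, smul_sub]
      rw [mul_comm (star z) z]
      abel
    have h2 : z * star z = ((‖z‖ ^ 2 : ℝ) : ℂ) := by
      rw [Complex.star_def, Complex.mul_conj, Complex.normSq_eq_norm_sq]
    rw [h1, he, he', hfix, smul_mul_assoc, mul_smul_comm, smul_smul, smul_smul,
      mul_comm (star z) z, ← mul_assoc, ← hQdef, h2, Complex.coe_smul]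
    abel
  have hDp : (channel (fun n => A n * M - z • (M * A n)) ρ).PosSemidef :=
    channel_posSemidef _ hρ.posSemidef
  have hz2 : 0 ≤ ‖z‖ ^ 2 - 1 := by nlinarith
  have hzQ := posSemidef_real_smul hQ hz2
  have hsum : channel A Q - Q =
      channel (fun n => A n * M - z • (M * A n)) ρ + (‖z‖ ^ 2 - 1) • Q := by
    rw [hD, sub_smul, one_smul]; abel
  have h0 := h.channel_eq_of_subharmonic hg hρ hρc hfix hQ (by rw [hsum]; exact hDp.add hzQ)
  rw [hsum] at h0
  have hD0 := eq_zero_of_posSemidef_add hDp hzQ h0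
  rw [hD0, zero_add, smul_eq_zero] at h0
  refine ⟨?_, fun n => sub_eq_zero.1 (eq_zero_of_channel_eq_zero _ hρ hD0 n)⟩
  rcases h0 with h0 | h0
  · nlinarith
  · exact absurd (eq_zero_of_channel_eq_zero (fun _ : Unit => M) hρ
      (by simpa [channel_apply] using h0) ()) hM

end FixedPoint

/-! ### Twisted intertwiners, Schur's lemma and the peripheral spectrum. -/

section Intertwiners

variable {σ ι : Type*} [Fintype ι] {Z : Matrix ι ι ℂ} {A : σ → Matrix ι ι ℂ}

/-- `M` intertwines the family `A` with its multiple `z A`. -/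
def Intertwines (A : σ → Matrix ι ι ℂ) (z : ℂ) (M : Matrix ι ι ℂ) : Prop :=
  ∀ n, A n * M = z • (M * A n)

theorem Intertwines.add {z : ℂ} {M N : Matrix ι ι ℂ} (hM : Intertwines A z M)
    (hN : Intertwines A z N) : Intertwines A z (M + N) := fun n => by
  rw [mul_add, hM, hN, add_mul, smul_add]

theorem Intertwines.sub {z : ℂ} {M N : Matrix ι ι ℂ} (hM : Intertwines A z M)
    (hN : Intertwines A z N) : Intertwines A z (M - N) := fun n => by
  rw [mul_sub, hM, hN, sub_mul, smul_sub]

theorem Intertwines.mul {z w : ℂ} {M N : Matrix ι ι ℂ} (hM : Intertwines A z M)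
    (hN : Intertwines A w N) : Intertwines A (z * w) (M * N) := fun n => by
  rw [← mul_assoc, hM, smul_mul_assoc, mul_assoc, hN, mul_smul_comm, smul_smul, mul_assoc]

theorem Intertwines.channel_mul [Fintype σ] {z : ℂ} {M : Matrix ι ι ℂ} (hM : Intertwines A z M)
    (X : Matrix ι ι ℂ) : channel A (M * X) = z • (M * channel A X) := by
  rw [channel_apply, channel_apply, Finset.mul_sum, Finset.smul_sum]
  refine Finset.sum_congr rfl fun n _ => ?_
  rw [← mul_assoc, hM, smul_mul_assoc, smul_mul_assoc]
  simp only [mul_assoc]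

variable [DecidableEq ι]

theorem Intertwines.pow {z : ℂ} {M : Matrix ι ι ℂ} (hM : Intertwines A z M) (k : ℕ) :
    Intertwines A (z ^ k) (M ^ k) := by
  induction k with
  | zero => intro n; simp
  | succ k ih => rw [pow_succ, pow_succ]; exact ih.mul hM

theorem Intertwines.wordProd {z : ℂ} {M : Matrix ι ι ℂ} (hM : Intertwines A z M) (q : ℕ) :
    Intertwines (fun I : Fin q → σ => wordProd A I) (z ^ q) M := by
  induction q with
  | zero => intro I; simp [FermionicMPS.wordProd]
  | succ q ih =>
    intro I
    have h := ih fun j => I j.succ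
    simp only [FermionicMPS.wordProd, List.ofFn_succ, List.prod_cons] at h ⊢
    rw [mul_assoc, h, mul_smul_comm, ← mul_assoc, hM, smul_mul_assoc, smul_smul, mul_assoc,
      pow_succ]

theorem Intertwines.conj {z : ℂ} {M : Matrix ι ι ℂ} (hg : IsGraded Z A)
    (hM : Intertwines A z M) : Intertwines A z (Z * M * Z) := by
  intro n
  obtain ⟨s, -, hs, hc⟩ := hg.comm n
  have hc' : A n * Z = s • (Z * A n) := by rw [hc, smul_smul, hs, one_smul]
  calc A n * (Z * M * Z) = (A n * Z) * M * Z := by simp only [mul_assoc]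
    _ = s • (Z * (A n * M) * Z) := by
        rw [hc', smul_mul_assoc, smul_mul_assoc]; simp only [mul_assoc]
    _ = z • (Z * M * (s • (A n * Z))) := by
        rw [hM]; simp only [mul_smul_comm, smul_mul_assoc, mul_assoc, smul_comm s z]
    _ = z • (Z * M * Z * A n) := by rw [← hc]; simp only [mul_assoc]

/-- The kernel of M is invariant under Z and all Aⁿ, because M commutes with them up to nonzero
scalars. The cases s = 1 and s = -1 serve even and odd M. -/
theorem IsGradedIrred.eq_zero_or_isUnit (h : IsGradedIrred Z A) {z s : ℂ} (hz : z ≠ 0)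
    (hs : s ≠ 0) {M : Matrix ι ι ℂ} (hM : Intertwines A z M) (hc : Z * M = s • (M * Z)) :
    M = 0 ∨ IsUnit M := by
  have hmem (x : ι → ℂ) : x ∈ LinearMap.ker M.mulVecLin ↔ M *ᵥ x = 0 := by simp
  rcases h (LinearMap.ker M.mulVecLin)
    (fun v hv => by
      rw [hmem] at hv ⊢
      have : M * Z = s⁻¹ • (Z * M) := by rw [hc, smul_smul, inv_mul_cancel₀ hs, one_smul]
      rw [mulVec_mulVec, this, smul_mulVec, ← mulVec_mulVec, hv, mulVec_zero, smul_zero])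
    (fun n v hv => by
      rw [hmem] at hv ⊢
      have : M * A n = z⁻¹ • (A n * M) := by rw [hM, smul_smul, inv_mul_cancel₀ hz, one_smul]
      rw [mulVec_mulVec, this, smul_mulVec, ← mulVec_mulVec, hv, mulVec_zero, smul_zero])
    with hb | ht
  · right
    rw [← mulVec_injective_iff_isUnit]
    exact LinearMap.ker_eq_bot.1 hb
  · left
    have := LinearMap.ker_eq_top.1 ht
    ext i j
    simpa using congrFun (LinearMap.congr_fun this (Pi.single j 1)) i

/-- Schur's lemma for even intertwiners. -/
theorem IsGradedIrred.exists_eq_smul_one (h : IsGradedIrred Z A) {M : Matrix ι ι ℂ}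
    (hM : Intertwines A 1 M) (hc : Z * M = M * Z) : ∃ c : ℂ, M = c • (1 : Matrix ι ι ℂ) := by
  rcases isEmpty_or_nonempty ι with he | hne
  · exact ⟨0, Subsingleton.elim _ _⟩
  obtain ⟨c, hev⟩ := Module.End.exists_eigenvalue (K := ℂ) (M.mulVecLin : Module.End ℂ (ι → ℂ))
  obtain ⟨v, hv⟩ := hev.exists_hasEigenvector
  have hv1 : M *ᵥ v = c • v := hv.apply_eq_smul
  refine ⟨c, sub_eq_zero.1 ?_⟩
  refine (h.eq_zero_or_isUnit one_ne_zero one_ne_zero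
    (hM.sub (N := c • 1) fun n => by simp) (by simp [mul_sub, sub_mul, hc])).resolve_right ?_
  intro hu
  rw [← mulVec_injective_iff_isUnit] at hu
  refine hv.2 (hu ?_)
  simp [sub_mulVec, smul_mulVec, hv1]

theorem exists_even_or_odd (hg : IsGraded Z A) {z : ℂ} {M : Matrix ι ι ℂ}
    (hM : Intertwines A z M) (h0 : M ≠ 0) :
    ∃ N, N ≠ 0 ∧ Intertwines A z N ∧ (Z * N = N * Z ∨ Z * N = (-1 : ℂ) • (N * Z)) := by
  by_cases he : M + Z * M * Z = 0
  · refine ⟨M - Z * M * Z, fun ho => h0 ?_, hM.sub (hM.conj hg), Or.inr (hg.odd_part M)⟩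
    have : (2 : ℂ) • M = (M + Z * M * Z) + (M - Z * M * Z) := by rw [two_smul]; abel
    rw [he, ho, add_zero] at this
    exact (smul_eq_zero.1 this).resolve_left two_ne_zero
  · exact ⟨_, he, hM.add (hM.conj hg), Or.inl (hg.even_part M)⟩

variable [Fintype σ] {ρ : Matrix ι ι ℂ}

theorem posDef_isUnit_det (hρ : ρ.PosDef) : IsUnit ρ.det :=
  (isUnit_iff_isUnit_det _).1 hρ.isUnit

/-- Since ρ is invertible, every eigenmatrix can be written as Mρ. -/
theorem IsGradedIrred.eigen_intertwines (hg : IsGraded Z A) (h : IsGradedIrred Z A)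
    (hρ : ρ.PosDef) (hρc : Z * ρ = ρ * Z) (hfix : channel A ρ = ρ) {Y : Matrix ι ι ℂ} {z : ℂ}
    (hY : Y ≠ 0) (hz : 1 ≤ ‖z‖) (he : channel A Y = z • Y) :
    ‖z‖ = 1 ∧ ∃ M, Y = M * ρ ∧ M ≠ 0 ∧ Intertwines A z M := by
  have hYM : Y * ρ⁻¹ * ρ = Y := nonsing_inv_mul_cancel_right _ _ (posDef_isUnit_det hρ)
  have hM : Y * ρ⁻¹ ≠ 0 := fun h0 => hY (by rw [← hYM, h0, zero_mul])
  obtain ⟨h1, h2⟩ := h.intertwine_of_eigen hg hρ hρc hfix hM hz (by rw [hYM, he])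
  exact ⟨h1, _, hYM.symm, hM, h2⟩

/-- An even intertwiner for a phase `z` forces `z = 1` when all blockings are irreducible. -/
theorem eq_one_of_even_intertwiner
    (h : ∀ q, 0 < q → IsGradedIrred Z fun I : Fin q → σ => wordProd A I)
    (h1 : IsGradedIrred Z A) (hA : ∃ n, A n ≠ 0) (hρ : ρ.PosDef) (hfix : channel A ρ = ρ)
    {z : ℂ} (hz : z ≠ 0) {M : Matrix ι ι ℂ} (hM : Intertwines A z M) (hM0 : M ≠ 0)
    (hc : Z * M = M * Z) : z = 1 := by
  have hu : IsUnit M := (h1.eq_zero_or_isUnit hz one_ne_zero hM (by rw [hc, one_smul])).resolve_left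
    hM0
  have hne : Nontrivial (Matrix ι ι ℂ) := ⟨_, _, hM0⟩
  have hev (k : ℕ) : Module.End.HasEigenvalue (channel A) (z ^ k) := by
    refine Module.End.hasEigenvalue_of_hasEigenvector (x := M ^ k * ρ) ⟨?_, ?_⟩
    · rw [Module.End.mem_eigenspace_iff, (hM.pow k).channel_mul, hfix]
    · exact ((hu.pow k).mul hρ.isUnit).ne_zero
  have hfin : Set.Finite (Module.End.HasEigenvalue (channel A)) :=
    Module.End.finite_hasEigenvalue _
  -- All powers of z are eigenvalues of Φ, of which there are finitely many, so two powers coincide.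
  obtain ⟨i, j, hij, heq⟩ : ∃ i j : ℕ, i < j ∧ z ^ i = z ^ j := by
    have : ¬ Function.Injective fun k : ℕ => z ^ k := fun hinj =>
      Set.infinite_range_of_injective hinj (hfin.subset (by rintro _ ⟨k, rfl⟩; exact hev k))
    simp only [Function.Injective, not_forall] at this
    obtain ⟨i, j, hij, hne⟩ := this
    rcases lt_or_gt_of_ne hne with hlt | hlt
    · exact ⟨i, j, hlt, hij⟩
    · exact ⟨j, i, hlt, hij.symm⟩
  have hq : z ^ (j - i) = 1 := by
    rw [← Nat.add_sub_of_le hij.le, pow_add] at heq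
    exact (mul_eq_left₀ (pow_ne_zero i hz)).1 heq.symm
  have hw := hM.wordProd (j - i)
  rw [hq] at hw
  obtain ⟨c, rfl⟩ := (h (j - i) (by omega)).exists_eq_smul_one hw hc
  have hc0 : c ≠ 0 := by rintro rfl; simp at hM0
  obtain ⟨n, hn⟩ := hA
  have := hM n
  rw [mul_smul_comm, mul_one, smul_mul_assoc, one_mul, smul_comm] at this
  have h2 : (1 : ℂ) • A n = z • A n := by
    rw [one_smul]; exact smul_right_injective _ hc0 this
  exact (smul_left_injective ℂ hn h2).symm

/-- When all blockings are irreducible, peripheral eigenvalues square to one. -/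
theorem sq_eq_one_of_eigen (hg : IsGraded Z A)
    (h : ∀ q, 0 < q → IsGradedIrred Z fun I : Fin q → σ => wordProd A I)
    (h1 : IsGradedIrred Z A) (hA : ∃ n, A n ≠ 0) (hρ : ρ.PosDef) (hρc : Z * ρ = ρ * Z)
    (hfix : channel A ρ = ρ) {Y : Matrix ι ι ℂ} {z : ℂ}
    (hY : Y ≠ 0) (hz : 1 ≤ ‖z‖) (he : channel A Y = z • Y) : z ^ 2 = 1 := by
  obtain ⟨-, M, -, hM0, hM⟩ := h1.eigen_intertwines hg hρ hρc hfix hY hz he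
  have hz0 : z ≠ 0 := by rintro rfl; norm_num at hz
  obtain ⟨N, hN0, hN, hev | hodd⟩ := exists_even_or_odd hg hM hM0
  · rw [eq_one_of_even_intertwiner h h1 hA hρ hfix hz0 hN hN0 hev, one_pow]
  · have hu := (h1.eq_zero_or_isUnit hz0 (by norm_num) hN hodd).resolve_left hN0
    have hne : Nontrivial (Matrix ι ι ℂ) := ⟨_, _, hN0⟩
    refine eq_one_of_even_intertwiner h h1 hA hρ hfix (pow_ne_zero 2 hz0) (hN.pow 2)
      (hu.pow 2).ne_zero ?_
    rw [pow_two, ← mul_assoc, hodd, smul_mul_assoc, mul_assoc, hodd, mul_smul_comm, smul_smul,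
      mul_assoc]
    simp

/-- The fixed space of an irreducible channel has dimension one or two. -/
theorem finrank_eigenspace_channel_one [Nonempty ι] (hg : IsGraded Z A) (h : IsGradedIrred Z A)
    (hρ : ρ.PosDef) (hρc : Z * ρ = ρ * Z) (hfix : channel A ρ = ρ) :
    Module.finrank ℂ (Module.End.eigenspace (channel A) 1) = 1 ∨
      Module.finrank ℂ (Module.End.eigenspace (channel A) 1) = 2 := by
  have hρ0 : ρ ≠ 0 := hρ.isUnit.ne_zero
  have hdecomp {Y : Matrix ι ι ℂ} (hY : Y ∈ Module.End.eigenspace (channel A) 1) :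
      -- The even part of an intertwiner is scalar by Schur's lemma, so only the odd part can
      -- contribute a new direction.
      ∃ (c : ℂ) (N : Matrix ι ι ℂ), Y = c • ρ + N * ρ ∧ Intertwines A 1 N ∧
        Z * N = (-1 : ℂ) • (N * Z) := by
    rcases eq_or_ne Y 0 with rfl | hY0
    · exact ⟨0, 0, by simp, fun n => by simp, by simp⟩
    obtain ⟨-, M, rfl, -, hM⟩ := h.eigen_intertwines hg hρ hρc hfix hY0 (z := 1) (by simp)
      (Module.End.mem_eigenspace_iff.1 hY)
    obtain ⟨c, hc⟩ := h.exists_eq_smul_one (hM.add (hM.conj hg)) (hg.even_part M)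
    refine ⟨2⁻¹ * c, (2⁻¹ : ℂ) • (M - Z * M * Z), ?_, fun n => ?_, ?_⟩
    · have : M = (2⁻¹ : ℂ) • ((M + Z * M * Z) + (M - Z * M * Z)) := by
        rw [add_add_sub_cancel, ← two_smul ℂ M, smul_smul]; norm_num
      conv_lhs => rw [this, hc]
      rw [smul_add, smul_smul, add_mul, smul_mul_assoc, one_mul]
    · rw [mul_smul_comm, (hM.sub (hM.conj hg)) n]; simp
    · rw [mul_smul_comm, hg.odd_part, smul_mul_assoc, smul_comm]
  by_cases hJ : ∃ J, J ≠ 0 ∧ Intertwines A 1 J ∧ Z * J = (-1 : ℂ) • (J * Z)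
  · right
    obtain ⟨J, hJ0, hJ, hJc⟩ := hJ
    have hJu := (h.eq_zero_or_isUnit one_ne_zero (by norm_num) hJ hJc).resolve_left hJ0
    -- Both J² and JN are even, hence scalars a and b with a ≠ 0, and J²N = aN = bJ.
    have hspan {N : Matrix ι ι ℂ} (hN : Intertwines A 1 N) (hNc : Z * N = (-1 : ℂ) • (N * Z)) :
        ∃ c : ℂ, N = c • J := by
      have heven {K : Matrix ι ι ℂ} (hKc : Z * K = (-1 : ℂ) • (K * Z)) :
          Z * (J * K) = (J * K) * Z := by
        rw [← mul_assoc, hJc, smul_mul_assoc, mul_assoc, hKc, mul_smul_comm, smul_smul,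
          mul_assoc]
        simp
      obtain ⟨a, ha⟩ := h.exists_eq_smul_one (by simpa using hJ.mul hJ) (heven hJc)
      obtain ⟨b, hb⟩ := h.exists_eq_smul_one (by simpa using hJ.mul hN) (heven hNc)
      have ha0 : a ≠ 0 := by
        rintro rfl
        rw [zero_smul] at ha
        exact (hJu.mul hJu).ne_zero ha
      refine ⟨a⁻¹ * b, ?_⟩
      have h1 : a • N = b • J := by
        calc a • N = (a • (1 : Matrix ι ι ℂ)) * N := by simp
          _ = J * (J * N) := by rw [← ha, mul_assoc]
          _ = b • J := by rw [hb]; simp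
      rw [mul_smul, ← h1, smul_smul, inv_mul_cancel₀ ha0, one_smul]
    have hli : LinearIndependent ℂ ![ρ, J * ρ] := by
      rw [LinearIndependent.pair_iff]
      intro a b hab
      have h1 : a • (1 : Matrix ι ι ℂ) + b • J = 0 := by
        have : (a • (1 : Matrix ι ι ℂ) + b • J) * ρ = 0 := by
          rw [add_mul, smul_mul_assoc, one_mul, smul_mul_assoc, hab]
        exact (hρ.isUnit.mul_left_eq_zero).1 this
      -- Conjugation by Z fixes the identity and flips the sign of the odd J.
      have h2 : a • (1 : Matrix ι ι ℂ) - b • J = 0 := by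
        have := congrArg (fun X => Z * X * Z) h1
        simp only [mul_add, add_mul, mul_smul_comm, smul_mul_assoc, mul_one, hg.sq, hJc, mul_zero,
          zero_mul, mul_assoc] at this
        rw [← this]; simp [sub_eq_add_neg]
      have h3 : (2 * a) • (1 : Matrix ι ι ℂ) = 0 := by
        rw [mul_smul, two_smul]
        calc _ = (a • (1 : Matrix ι ι ℂ) + b • J) + (a • (1 : Matrix ι ι ℂ) - b • J) := by abel
          _ = 0 := by rw [h1, h2, add_zero]
      have ha : a = 0 := by simpa using h3
      refine ⟨ha, ?_⟩
      rw [ha, zero_smul, zero_add, smul_eq_zero] at h1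
      exact h1.resolve_right hJ0
    have : Module.End.eigenspace (channel A) 1 = Submodule.span ℂ (Set.range ![ρ, J * ρ]) := by
      refine le_antisymm (fun Y hY => ?_) (Submodule.span_le.2 ?_)
      · obtain ⟨c, N, rfl, hN, hNc⟩ := hdecomp hY
        obtain ⟨b, rfl⟩ := hspan hN hNc
        simp only [Matrix.range_cons, Matrix.range_empty, Set.union_empty, Set.singleton_union]
        exact Submodule.mem_span_pair.2 ⟨c, b, by rw [smul_mul_assoc]⟩
      · rintro _ ⟨i, rfl⟩
        rw [SetLike.mem_coe, Module.End.mem_eigenspace_iff]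
        fin_cases i
        · simpa using hfix
        · simp [hJ.channel_mul, hfix]
    rw [this, finrank_span_eq_card hli, Fintype.card_fin]
  · left
    have : Module.End.eigenspace (channel A) 1 = Submodule.span ℂ {ρ} := by
      refine le_antisymm (fun Y hY => ?_) ?_
      · obtain ⟨c, N, rfl, hN, hNc⟩ := hdecomp hY
        have hN0 : N = 0 := by_contra fun hne => hJ ⟨N, hne, hN, hNc⟩
        rw [hN0, zero_mul, add_zero]
        exact Submodule.smul_mem _ _ (Submodule.mem_span_singleton_self _)
      · rw [Submodule.span_singleton_le_iff_mem, Module.End.mem_eigenspace_iff, one_smul, hfix]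
    rw [this, finrank_span_singleton hρ0]

end Intertwiners

theorem IsGradedIrred.of_smul {σ ι : Type*} [Fintype ι] {Z : Matrix ι ι ℂ} {A B : σ → Matrix ι ι ℂ} {c : ℂ}
    (h : IsGradedIrred Z A) (hAB : ∀ n, A n = c • B n) : IsGradedIrred Z B :=
  fun W hZ hB => h W hZ fun n v hv => by
    rw [hAB, smul_mulVec]; exact W.smul_mem _ (hB n v hv)

/-! ### Words of a family and powers of its channel. -/

section Words

variable {σ ι : Type*} [Fintype ι] [DecidableEq ι]

theorem wordProd_zero (A : σ → Matrix ι ι ℂ) (I : Fin 0 → σ) : wordProd A I = 1 := by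
  simp [wordProd]

theorem wordProd_succ (A : σ → Matrix ι ι ℂ) {p : ℕ} (I : Fin (p + 1) → σ) :
    wordProd A I = A (I 0) * wordProd A fun j => I j.succ := by
  simp [wordProd, List.ofFn_succ]

theorem wordProd_smul (A : σ → Matrix ι ι ℂ) (c : ℂ) {p : ℕ} (I : Fin p → σ) :
    wordProd (fun n => c • A n) I = c ^ p • wordProd A I := by
  induction p with
  | zero => simp [wordProd_zero]
  | succ p ih =>
    rw [wordProd_succ, wordProd_succ, ih, smul_mul_smul_comm, pow_succ']

theorem wordProd_mulVec_mem {A : σ → Matrix ι ι ℂ} {W : Submodule ℂ (ι → ℂ)}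
    (hW : ∀ n, ∀ v ∈ W, A n *ᵥ v ∈ W) {p : ℕ} (I : Fin p → σ) {v : ι → ℂ} (hv : v ∈ W) :
    wordProd A I *ᵥ v ∈ W := by
  induction p with
  | zero => simpa [wordProd_zero]
  | succ p ih =>
    rw [wordProd_succ, ← mulVec_mulVec]
    exact hW _ _ (ih _)

theorem IsGradedIrred.of_wordProd {Z : Matrix ι ι ℂ} {A : σ → Matrix ι ι ℂ} {q : ℕ}
    (h : IsGradedIrred Z fun I : Fin q → σ => wordProd A I) : IsGradedIrred Z A :=
  fun W hZ hA => h W hZ fun I _ hv => wordProd_mulVec_mem hA I hv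

theorem channel_wordProd [Fintype σ] (A : σ → Matrix ι ι ℂ) (p : ℕ) :
    channel (fun I : Fin p → σ => wordProd A I) = channel A ^ p := by
  induction p with
  | zero => ext1 X; simp [channel_apply, wordProd_zero]
  | succ p ih =>
    ext1 X
    rw [pow_succ', ← ih, Module.End.mul_apply, channel_apply, channel_apply, channel_apply,
      ← (Fin.consEquiv fun _ => σ).sum_comp, Fintype.sum_prod_type]
    refine Finset.sum_congr rfl fun n _ => ?_
    rw [Finset.mul_sum, Finset.sum_mul]
    refine Finset.sum_congr rfl fun I _ => ?_
    simp [wordProd_succ, Fin.consEquiv, mul_assoc]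

end Words

/-! ### The parity operator as a self-adjoint involution. -/

section Parity

theorem paritySign_one : paritySign 1 = -1 := by
  change (-1 : ℂ) ^ 1 = -1
  rw [pow_one]

theorem paritySign_eq (a : ZMod 2) : paritySign a = 1 ∨ paritySign a = -1 := by
  fin_cases a
  · left; exact paritySign_zero
  · right; exact paritySign_one

theorem star_paritySign (a : ZMod 2) : star (paritySign a) = paritySign a := by
  rcases paritySign_eq a with h | h <;> simp [h]

theorem paritySign_mul_self (a : ZMod 2) : paritySign a * paritySign a = 1 := by
  rcases paritySign_eq a with h | h <;> simp [h]

variable {ι : Type*} [DecidableEq ι]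

theorem parityOperator_conjTranspose (q : ι → ZMod 2) :
    (parityOperator q)ᴴ = parityOperator q := by
  rw [parityOperator, diagonal_conjTranspose]
  congr 1
  ext i
  exact star_paritySign _

theorem parityOperator_mul_self [Fintype ι] (q : ι → ZMod 2) :
    parityOperator q * parityOperator q = 1 := by
  simp [parityOperator, paritySign_mul_self]

end Parity

/-! ### From the channel to graded normal tensors. -/

namespace EvenTensor

variable {σ ι : Type*} {phys : σ → ZMod 2} [Fintype ι] [DecidableEq ι]

theorem isGraded (A : EvenTensor phys ι) : IsGraded (parityOperator A.parity) A.mat where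
  herm := parityOperator_conjTranspose _
  sq := parityOperator_mul_self _
  comm n := ⟨_, star_paritySign _, paritySign_mul_self _, A.even n⟩

/-- As Z is self-adjoint, invariance of W passes to its orthogonal complement, which makes the
projector commute with Z. -/
theorem isGradedSubspace_iff (A : EvenTensor phys ι) (W : Submodule ℂ (EuclideanSpace ℂ ι)) :
    A.IsGradedSubspace W ↔
      ∀ v ∈ W, Matrix.toEuclideanCLM (𝕜 := ℂ) (parityOperator A.parity) v ∈ W := by
  set T := Matrix.toEuclideanCLM (𝕜 := ℂ) (parityOperator A.parity) with hT
  constructor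
  · intro h v hv
    have h1 : W.starProjection (T v) = T (W.starProjection v) :=
      DFunLike.congr_fun (show W.starProjection * T = T * W.starProjection from h) v
    rw [Submodule.starProjection_eq_self_iff.2 hv] at h1
    exact Submodule.starProjection_eq_self_iff.1 h1
  · intro h
    have hsa (u v : EuclideanSpace ℂ ι) : inner ℂ u (T v) = inner ℂ (T u) v := by
      rw [EuclideanSpace.inner_eq_star_dotProduct, EuclideanSpace.inner_eq_star_dotProduct,
        dotProduct_comm, dotProduct_comm (v.ofLp), hT, Matrix.ofLp_toEuclideanCLM,
        Matrix.ofLp_toEuclideanCLM, star_dotProduct_mulVec_eq, parityOperator_conjTranspose]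
    have key (v : EuclideanSpace ℂ ι) : W.starProjection (T v) = T (W.starProjection v) := by
      refine Submodule.eq_starProjection_of_mem_of_inner_eq_zero
        (h _ (Submodule.starProjection_apply_mem W v)) fun w hw => ?_
      rw [← map_sub, ← hsa]
      exact Submodule.starProjection_inner_eq_zero v _ (h w hw)
    exact ContinuousLinearMap.ext key

theorem isGradedIrreducible_iff (A : EvenTensor phys ι) :
    A.IsGradedIrreducible ↔ IsGradedIrred (parityOperator A.parity) A.mat := by
  let e := WithLp.linearEquiv 2 ℂ (ι → ℂ)
  constructor
  · intro h W hZ hA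
    rcases h (W.comap e.toLinearMap) ((A.isGradedSubspace_iff _).2 fun v hv => hZ _ hv)
      (fun n v hv => hA n _ hv) with hb | ht
    · left
      rw [eq_bot_iff]
      intro w hw
      have : e.symm w ∈ W.comap e.toLinearMap := by simpa using hw
      rw [hb, Submodule.mem_bot] at this
      simpa using this
    · right
      rw [eq_top_iff]
      intro w _
      have : e.symm w ∈ W.comap e.toLinearMap := ht ▸ Submodule.mem_top
      simpa using this
  · intro h W hZ hA
    rw [isGradedSubspace_iff] at hZ
    rcases h (W.comap e.symm.toLinearMap) (fun v hv => hZ _ hv) (fun n v hv => hA n _ hv)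
      with hb | ht
    · left
      rw [eq_bot_iff]
      intro w hw
      have : e w ∈ W.comap e.symm.toLinearMap := by simpa using hw
      rw [hb, Submodule.mem_bot] at this
      simpa using this
    · right
      rw [eq_top_iff]
      intro w _
      have : e w ∈ W.comap e.symm.toLinearMap := ht ▸ Submodule.mem_top
      simpa using this

/-- The transfer matrix is the matrix of the channel. -/
theorem charpoly_transferMatrix [Fintype σ] (A : EvenTensor phys ι) :
    A.transferMatrix.charpoly = LinearMap.charpoly (channel A.mat) := by
  let e : Matrix ι ι ℂ ≃ₗ[ℂ] (ι × ι → ℂ) := (LinearEquiv.curry ℂ ℂ ι ι).symm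
  rw [← LinearEquiv.charpoly_conj e, ← Matrix.charpoly_toLin']
  congr 1
  refine LinearMap.ext fun v => ?_
  obtain ⟨X, rfl⟩ := e.surjective v
  rw [LinearEquiv.conj_apply_apply, e.symm_apply_apply, Matrix.toLin'_apply]
  ext ⟨i, j⟩
  have hR : e (channel A.mat X) (i, j) = channel A.mat X i j := rfl
  rw [hR, channel_apply, transferMatrix, sum_mulVec, Finset.sum_apply, Matrix.sum_apply]
  refine Finset.sum_congr rfl fun n _ => ?_
  have hX (a b : ι) : e X (a, b) = X a b := rfl
  simp only [mulVec, dotProduct, Fintype.sum_prod_type, kronecker_apply, map_apply, hX, mul_apply,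
    conjTranspose_apply, Finset.sum_mul]
  rw [Finset.sum_comm]
  refine Finset.sum_congr rfl fun b _ => Finset.sum_congr rfl fun a _ => ?_
  rw [Complex.star_def]; ring

theorem mem_spectrum_transferMatrix [Fintype σ] (A : EvenTensor phys ι) (z : ℂ) :
    z ∈ spectrum ℂ A.transferMatrix ↔ Module.End.HasEigenvalue (channel A.mat) z := by
  rw [Matrix.mem_spectrum_iff_isRoot_charpoly, charpoly_transferMatrix,
    ← Module.End.mem_spectrum_iff_isRoot_charpoly, Module.End.hasEigenvalue_iff_mem_spectrum]

/-- By `hper` only the multiplicity of 1 is open. Without Jordan blocks the algebraic multiplicity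
is the dimension of the fixed space, which is one or two. -/
theorem isGNT_of_channel [Fintype σ] [Nonempty ι] (A : EvenTensor phys ι)
    (h : A.IsGradedIrreducible) {ρ : Matrix ι ι ℂ} (hρ : ρ.PosDef)
    (hρc : parityOperator A.parity * ρ = ρ * parityOperator A.parity)
    (hfix : channel A.mat ρ = ρ)
    (hper : ∀ z : ℂ, 1 ≤ ‖z‖ → Module.End.HasEigenvalue (channel A.mat) z → z = 1) :
    A.IsGNT := by
  have hone : Module.End.HasEigenvalue (channel A.mat) 1 :=
    Module.End.hasEigenvalue_of_hasEigenvector (x := ρ)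
      ⟨by rw [Module.End.mem_eigenspace_iff, one_smul, hfix], hρ.isUnit.ne_zero⟩
  have hrad : spectralRadius ℂ A.transferMatrix = 1 := by
    refine le_antisymm (iSup₂_le fun z hz => ?_) ?_
    · rw [mem_spectrum_transferMatrix] at hz
      have : ‖z‖ ≤ 1 := by
        by_contra! hlt
        rw [hper z hlt.le hz] at hlt
        simp at hlt
      exact_mod_cast this
    · refine le_trans ?_ (le_iSup₂ (f := fun (k : ℂ) (_ : k ∈ spectrum ℂ A.transferMatrix) =>
        (‖k‖₊ : ENNReal)) 1 ((A.mem_spectrum_transferMatrix 1).2 hone))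
      simp
  have hrep : A.peripheralEigenvalues =
      Multiset.replicate (Module.finrank ℂ (Module.End.eigenspace (channel A.mat) 1)) 1 := by
    classical
    have hall : ∀ z ∈ A.peripheralEigenvalues, z = 1 := by
      intro z hz
      rw [peripheralEigenvalues, Multiset.mem_filter, charpoly_transferMatrix] at hz
      refine hper z hz.2.ge ?_
      rw [Module.End.hasEigenvalue_iff_isRoot_charpoly]
      exact Polynomial.isRoot_of_mem_roots hz.1
    have hcard := Multiset.eq_replicate_card.2 hall
    have hcount : A.peripheralEigenvalues.count 1 =
        Module.finrank ℂ (Module.End.eigenspace (channel A.mat) 1) := by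
      rw [← maxGenEigenspace_channel_one hρ hfix, LinearMap.finrank_maxGenEigenspace_eq,
        ← charpoly_transferMatrix, ← Polynomial.count_roots, peripheralEigenvalues]
      convert Multiset.count_filter_of_pos (p := fun z : ℂ => ‖z‖ = 1) (a := (1 : ℂ)) (by simp)
    rw [← hcount]
    conv_lhs => rw [hcard]
    rw [hcard, Multiset.count_replicate_self, Multiset.card_replicate]
  have hirr := A.isGradedIrreducible_iff.1 h
  rcases finrank_eigenspace_channel_one A.isGraded hirr hρ hρc hfix with h1 | h2
  · exact Or.inl ⟨h, hrad, by rw [hrep, h1]; rfl⟩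
  · exact Or.inr ⟨h, hrad, by rw [hrep, h2]; rfl⟩

/-- The tensor with matrices `c Aⁿ`. -/
def smul (c : ℂ) (A : EvenTensor phys ι) : EvenTensor phys ι where
  mat n := c • A.mat n
  parity := A.parity
  even n := by rw [mul_smul_comm, A.even, smul_mul_assoc, smul_comm]

/-- If all blockings are graded irreducible, then even blockings are multiples of graded normal
tensors. -/
theorem exists_isGNT_block [Fintype σ] (A : EvenTensor phys ι)
    (h : ∀ q, 0 < q → (A.block q).IsGradedIrreducible) (hA : ∃ n, A.mat n ≠ 0)
    {m : ℕ} (hm : 0 < m) (h2 : 2 ∣ m) : ∃ (c : ℂ) (B : EvenTensor (blockParity phys m) ι),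
      B.IsGNT ∧ ∀ I, (A.block m).mat I = c • B.mat I := by
  have hne : Nonempty ι := by
    obtain ⟨n, hn⟩ := hA
    by_contra hne
    rw [not_nonempty_iff] at hne
    exact hn (Subsingleton.elim _ _)
  have hw (q : ℕ) (hq : 0 < q) := (A.block q).isGradedIrreducible_iff.1 (h q hq)
  obtain ⟨r, ρ, hr, hρ, hρc, hfix⟩ := (hw 1 one_pos).of_wordProd.exists_perron A.isGraded hA
  -- The channel is quadratic in the matrices, so dividing them by √r normalizes the Perron
  -- eigenvalue r to 1.
  set a : ℂ := ((√r : ℝ) : ℂ) with ha_def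
  have ha : a ≠ 0 := Complex.ofReal_ne_zero.2 (Real.sqrt_pos.2 hr).ne'
  have haa : a⁻¹ * star a⁻¹ * r = 1 := by
    rw [star_inv₀, ha_def, Complex.star_def, Complex.conj_ofReal, ← mul_inv, ← Complex.ofReal_mul,
      Real.mul_self_sqrt hr.le, inv_mul_cancel₀ (Complex.ofReal_ne_zero.2 hr.ne')]
  let A₁ := A.smul a⁻¹
  have hword (q : ℕ) (I : Fin q → σ) : wordProd A.mat I = a ^ q • wordProd A₁.mat I := by
    rw [show A₁.mat = fun n => a⁻¹ • A.mat n from rfl, wordProd_smul, smul_smul, ← mul_pow,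
      mul_inv_cancel₀ ha, one_pow, one_smul]
  have hw₁ (q : ℕ) (hq : 0 < q) :
      IsGradedIrred (parityOperator A₁.parity) fun I : Fin q → σ => wordProd A₁.mat I :=
    (hw q hq).of_smul (hword q)
  have hfix₁ : channel A₁.mat ρ = ρ := by
    have : channel A₁.mat ρ = (a⁻¹ * star a⁻¹) • channel A.mat ρ := by
      rw [channel_apply, channel_apply, Finset.smul_sum]
      refine Finset.sum_congr rfl fun n _ => ?_
      rw [show A₁.mat n = a⁻¹ • A.mat n from rfl, conjTranspose_smul, smul_mul_assoc,
        smul_mul_smul_comm]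
    rw [this, hfix, ← Complex.coe_smul, smul_smul, haa, one_smul]
  have hA₁ : ∃ n, A₁.mat n ≠ 0 := by
    obtain ⟨n, hn⟩ := hA
    exact ⟨n, smul_ne_zero (inv_ne_zero ha) hn⟩
  refine ⟨a ^ m, A₁.block m, ?_, hword m⟩
  have hch : channel (A₁.block m).mat = channel A₁.mat ^ m := channel_wordProd _ _
  have hpow (k : ℕ) : (channel A₁.mat ^ k) ρ = ρ := by
    induction k with
    | zero => simp
    | succ k ih => rw [pow_succ, Module.End.mul_apply, hfix₁, ih]
  refine isGNT_of_channel _ ((isGradedIrreducible_iff _).2 (hw₁ m hm)) hρ hρc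
    (by rw [hch, hpow]) fun z hz hev => ?_
  rw [hch, Module.End.hasEigenvalue_iff_mem_spectrum, spectrum.map_pow_of_pos _ hm] at hev
  obtain ⟨y, hy, rfl⟩ := hev
  rw [← Module.End.hasEigenvalue_iff_mem_spectrum] at hy
  obtain ⟨Y, hY⟩ := hy.exists_hasEigenvector
  have hy1 : 1 ≤ ‖y‖ := by
    rw [norm_pow] at hz
    by_contra! hlt
    exact absurd hz (not_le.2 (pow_lt_one₀ (norm_nonneg _) hlt hm.ne'))
  have hsq := sq_eq_one_of_eigen A₁.isGraded hw₁ (hw₁ 1 one_pos).of_wordProd hA₁ hρ hρc hfix₁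
    hY.2 hy1 hY.apply_eq_smul
  -- Eigenvalues of the blocked channel are powers y ^ m. Peripheral y satisfy y² = 1, so an even m
  -- removes the eigenvalue -1.
  obtain ⟨k, rfl⟩ := h2
  change y ^ (2 * k) = 1
  rw [pow_mul, hsq, one_pow]

end EvenTensor

/-! ### Splitting a graded reducible tensor. -/

section Splitting

variable {σ ι : Type*} {phys : σ → ZMod 2} [Fintype ι] [DecidableEq ι]

/-- A submodule invariant under a symmetric involution has a basis of eigenvectors. -/
theorem exists_parity_basis {E : Type*} [NormedAddCommGroup E] [InnerProductSpace ℂ E]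
    [FiniteDimensional ℂ E] {S : E →ₗ[ℂ] E} (hS : S.IsSymmetric) (hS2 : S * S = 1)
    (U : Submodule ℂ E) (hU : ∀ v ∈ U, S v ∈ U) :
    ∃ (b : Module.Basis (Fin (Module.finrank ℂ U)) ℂ U)
      (q : Fin (Module.finrank ℂ U) → ZMod 2),
      ∀ i, S (b i) = paritySign (q i) • (b i : E) := by
  have hr := hS.restrict_invariant hU
  let b := hr.eigenvectorBasis rfl
  have hb (i) : S (b i) = (hr.eigenvalues rfl i : ℂ) • (b i : E) :=
    congrArg Subtype.val (hr.apply_eigenvectorBasis rfl i)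
  have hev (i) : ((hr.eigenvalues rfl i : ℝ) : ℂ) = 1 ∨ ((hr.eigenvalues rfl i : ℝ) : ℂ) = -1 := by
    have h1 : (b i : E) = S (S (b i)) := (LinearMap.congr_fun hS2 _).symm
    rw [hb, map_smul, hb, smul_smul] at h1
    have h0 : (b i : E) ≠ 0 := by
      simpa using b.toBasis.ne_zero i
    rw [← mul_self_eq_one_iff]
    refine smul_left_injective ℂ h0 ?_
    simpa using h1.symm
  have hq (i) : ∃ a : ZMod 2, paritySign a = ((hr.eigenvalues rfl i : ℝ) : ℂ) := by
    rcases hev i with h | h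
    · exact ⟨0, by rw [h, paritySign_zero]⟩
    · exact ⟨1, by rw [h, paritySign_one]⟩
  choose q hq using hq
  refine ⟨b.toBasis, q, fun i => ?_⟩
  rw [hq, OrthonormalBasis.coe_toBasis, hb]

theorem parityOperator_mul_apply (q : ι → ZMod 2) (M : Matrix ι ι ℂ) (i j : ι) :
    (parityOperator q * M) i j = paritySign (q i) * M i j := by
  rw [parityOperator, diagonal_mul]

theorem mul_parityOperator_apply (q : ι → ZMod 2) (M : Matrix ι ι ℂ) (i j : ι) :
    (M * parityOperator q) i j = M i j * paritySign (q j) := by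
  rw [parityOperator, mul_diagonal]

namespace EvenTensor

theorem even_apply (A : EvenTensor phys ι) (n : σ) (i j : ι) :
    paritySign (A.parity i) * A.mat n i j =
      paritySign (phys n) * (A.mat n i j * paritySign (A.parity j)) := by
  rw [← parityOperator_mul_apply, ← mul_parityOperator_apply, A.even, Matrix.smul_apply, smul_eq_mul]

/-- The compression of an even tensor to part of the basis of the auxiliary space. -/
def compress {κ : Type*} [Fintype κ] [DecidableEq κ] (A : EvenTensor phys ι) (f : κ → ι) :
    EvenTensor phys κ where
  mat n := (A.mat n).submatrix f f
  parity i := A.parity (f i)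
  even n := by
    ext i j
    rw [parityOperator_mul_apply, Matrix.smul_apply, mul_parityOperator_apply, smul_eq_mul]
    exact A.even_apply n (f i) (f j)

theorem trace_wordProd_of_triangular {κ₁ κ₂ : Type*} [Fintype κ₁] [DecidableEq κ₁] [Fintype κ₂]
    [DecidableEq κ₂] (A : EvenTensor phys (κ₁ ⊕ κ₂))
    (h : ∀ n j i, A.mat n (Sum.inr j) (Sum.inl i) = 0) {N : ℕ} (I : Fin N → σ) :
    (wordProd A.mat I).trace = (wordProd (A.compress Sum.inl).mat I).trace +
      (wordProd (A.compress Sum.inr).mat I).trace := by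
  suffices hs : ∃ X, wordProd A.mat I = fromBlocks (wordProd (A.compress Sum.inl).mat I) X 0
      (wordProd (A.compress Sum.inr).mat I) by
    obtain ⟨X, hX⟩ := hs
    rw [hX]
    simp [trace, Fintype.sum_sum_type]
  induction N with
  | zero => exact ⟨0, by simp [wordProd_zero]⟩
  | succ N ih =>
    obtain ⟨X, hX⟩ := ih fun j => I j.succ
    obtain ⟨X', hA⟩ : ∃ X', A.mat (I 0) = fromBlocks ((A.compress Sum.inl).mat (I 0)) X' 0
        ((A.compress Sum.inr).mat (I 0)) := by
      refine ⟨(A.mat (I 0)).toBlocks₁₂, ?_⟩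
      conv_lhs => rw [← fromBlocks_toBlocks (A.mat (I 0))]
      congr 1
      ext j i
      exact h _ j i
    refine ⟨(A.compress Sum.inl).mat (I 0) * X +
      X' * wordProd (A.compress Sum.inr).mat fun j => I j.succ, ?_⟩
    rw [wordProd_succ, hX, hA, fromBlocks_multiply, wordProd_succ, wordProd_succ]
    simp only [Matrix.mul_zero, Matrix.zero_mul, add_zero, zero_add]

/-- A graded reducible even tensor generates the sum of the states of two smaller ones. -/
theorem exists_split (A : EvenTensor phys ι) (h : ¬ A.IsGradedIrreducible) :
    ∃ (n₁ n₂ : ℕ) (B₁ : EvenTensor phys (Fin n₁)) (B₂ : EvenTensor phys (Fin n₂)),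
      n₁ < Fintype.card ι ∧ n₂ < Fintype.card ι ∧ ∀ (N : ℕ) (I : Fin N → σ),
        (wordProd A.mat I).trace = (wordProd B₁.mat I).trace + (wordProd B₂.mat I).trace := by
  simp only [IsGradedIrreducible, not_forall, not_or] at h
  obtain ⟨W, hWg, hWA, hbot, htop⟩ := h
  rw [isGradedSubspace_iff] at hWg
  let S : EuclideanSpace ℂ ι →ₗ[ℂ] EuclideanSpace ℂ ι :=
    Matrix.toEuclideanLin (parityOperator A.parity)
  have hS : S.IsSymmetric :=
    (Matrix.isSymmetric_toEuclideanLin_iff).2 (parityOperator_conjTranspose _)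
  have hS2 : S * S = 1 := by
    refine LinearMap.ext fun v => ?_
    simp [S, Matrix.toLpLin_apply, mulVec_mulVec, parityOperator_mul_self]
  have hWo : ∀ v ∈ Wᗮ, S v ∈ Wᗮ := fun v hv => by
    rw [Submodule.mem_orthogonal] at hv ⊢
    intro w hw
    rw [← hS]
    exact hv _ (hWg w hw)
  obtain ⟨b₁, q₁, h₁⟩ := exists_parity_basis hS hS2 W hWg
  obtain ⟨b₂, q₂, h₂⟩ := exists_parity_basis hS hS2 Wᗮ hWo
  have hcompl : IsCompl W Wᗮ := Submodule.isCompl_orthogonal W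
  let e := Submodule.prodEquivOfIsCompl W Wᗮ hcompl
  let b := ((b₁.prod b₂).map e).map (WithLp.linearEquiv 2 ℂ (ι → ℂ))
  let q := Sum.elim q₁ q₂
  -- The change of basis is taken as an algebra isomorphism, so words and the evenness relation
  -- carry over at once.
  let φ : Matrix ι ι ℂ ≃ₐ[ℂ] _ := Matrix.toLinAlgEquiv'.trans (LinearMap.toMatrixAlgEquiv b)
  have hφ (X : Matrix ι ι ℂ) (k l) : φ X k l = b.repr (X *ᵥ b l) k := by
    simp [φ, LinearMap.toMatrixAlgEquiv_apply]
  have hb (k) : parityOperator A.parity *ᵥ b k = paritySign (q k) • b k := by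
    rcases k with i | i
    · simpa [b, e, q, S, Matrix.toLpLin_apply] using congrArg WithLp.ofLp (h₁ i)
    · simpa [b, e, q, S, Matrix.toLpLin_apply] using congrArg WithLp.ofLp (h₂ i)
  have hφZ : φ (parityOperator A.parity) = parityOperator q := by
    ext k l
    rw [hφ, hb, map_smul, Module.Basis.repr_self, parityOperator, diagonal_apply]
    by_cases hkl : k = l
    · subst hkl; simp
    · simp [hkl]
  let C : EvenTensor phys (Fin (Module.finrank ℂ W) ⊕ Fin (Module.finrank ℂ Wᗮ)) :=
    { mat := fun n => φ (A.mat n)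
      parity := q
      even := fun n => by rw [← hφZ, ← map_mul, A.even, map_smul, map_mul] }
  have htri (n j i) : C.mat n (Sum.inr j) (Sum.inl i) = 0 := by
    have hmem : WithLp.toLp 2 (A.mat n *ᵥ b (Sum.inl i)) ∈ W := by
      have := hWA n (b₁ i) (b₁ i).2
      have hbi : b (Sum.inl i) = (b₁ i : EuclideanSpace ℂ ι).ofLp := by simp [b, e]
      rw [hbi]
      exact this
    change φ (A.mat n) _ _ = 0
    rw [hφ]
    have he : e.symm (WithLp.toLp 2 (A.mat n *ᵥ b (Sum.inl i))) = (⟨_, hmem⟩, 0) :=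
      Submodule.prodEquivOfIsCompl_symm_apply_left W Wᗮ hcompl ⟨_, hmem⟩
    simp only [b, Module.Basis.map_repr, LinearEquiv.trans_apply, Module.Basis.prod_repr_inr]
    change b₂.repr (e.symm (WithLp.toLp 2 (A.mat n *ᵥ b (Sum.inl i)))).2 j = 0
    rw [he]; simp
  have hword {N : ℕ} (I : Fin N → σ) : wordProd C.mat I = φ (wordProd A.mat I) := by
    induction N with
    | zero => simp [wordProd_zero]
    | succ N ih => rw [wordProd_succ, wordProd_succ, ih, map_mul]
  have htr (X : Matrix ι ι ℂ) : (φ X).trace = X.trace := by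
    rw [← Matrix.trace_toLin'_eq X, LinearMap.trace_eq_matrix_trace ℂ b]
    rfl
  have hcard : Module.finrank ℂ (EuclideanSpace ℂ ι) = Fintype.card ι := finrank_euclideanSpace
  have hadd := Submodule.finrank_add_finrank_orthogonal W
  have hlt := Submodule.finrank_lt htop
  have hpos : 0 < Module.finrank ℂ W := Submodule.one_le_finrank_iff.2 hbot
  refine ⟨_, _, C.compress Sum.inl, C.compress Sum.inr, by omega, by omega, fun N I => ?_⟩
  rw [← trace_wordProd_of_triangular C htri, hword, htr]

end EvenTensor

end Splitting

/-! ### Iterated blocking. -/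

section Blocking

/-- Words of `s q` letters as words of `s` blocks of `q` letters. -/
def blockEquiv (σ : Type*) (s q : ℕ) : (Fin (s * q) → σ) ≃ (Fin s → Fin q → σ) :=
  (finProdFinEquiv.symm.arrowCongr (Equiv.refl σ)).trans (Equiv.curry (Fin s) (Fin q) σ)

theorem blockEquiv_apply {σ : Type*} {s q : ℕ} (I : Fin (s * q) → σ) (i : Fin s) (j : Fin q) :
    blockEquiv σ s q I i j = I (finProdFinEquiv (i, j)) := rfl

theorem wordProd_blockEquiv {σ ι : Type*} [Fintype ι] [DecidableEq ι] (A : σ → Matrix ι ι ℂ)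
    {s q : ℕ} (I : Fin (s * q) → σ) :
    wordProd (fun J : Fin q → σ => wordProd A J) (blockEquiv σ s q I) = wordProd A I := by
  simp only [wordProd, List.ofFn_mul, List.prod_flatten, List.map_ofFn]
  congr 2
  ext i : 1
  simp only [Function.comp_apply]
  congr 2
  ext j : 1
  rw [blockEquiv_apply]
  congr 2
  ext
  simp [finProdFinEquiv, add_comm, mul_comm]

theorem blockParity_blockEquiv {σ : Type*} (phys : σ → ZMod 2) {s q : ℕ} (I : Fin (s * q) → σ) :
    blockParity (blockParity phys q) s (blockEquiv σ s q I) = blockParity phys (s * q) I := by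
  simp only [blockParity, blockEquiv_apply]
  rw [← finProdFinEquiv.sum_comp, Fintype.sum_prod_type]

end Blocking

/-! ### Sums of graded normal states and the induction on the bond dimension. -/

/-- The coefficients `f` are those of a weighted sum of states of graded normal tensors. -/
def HasCanonicalTraces {σ : Type} [Fintype σ] (phys : σ → ZMod 2)
    (f : ∀ N : ℕ, (Fin N → σ) → ℂ) : Prop :=
  ∃ (κ : Type) (_ : Fintype κ) (D : κ → ℕ) (μ : κ → ℂ) (B : ∀ k, EvenTensor phys (Fin (D k))),
    (∀ k, (B k).IsGNT) ∧
      ∀ N, 0 < N → ∀ I, f N I = ∑ k, μ k ^ N * (wordProd (B k).mat I).trace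

/-- The transfer matrix and the family of matrices do not depend on how physical letters are
labelled. This identifies blocks of blocks with single long blocks. -/
theorem EvenTensor.IsGNT.comp_equiv {σ τ ι : Type*} [Fintype σ] [Fintype τ] [Fintype ι]
    [DecidableEq ι] {phys : σ → ZMod 2} {phys' : τ → ZMod 2} (e : σ ≃ τ)
    {B : EvenTensor phys' ι} (hB : B.IsGNT) {C : EvenTensor phys ι} (hp : C.parity = B.parity)
    (hC : ∀ n, C.mat n = B.mat (e n)) : C.IsGNT := by
  have ht : C.transferMatrix = B.transferMatrix := by
    simp only [EvenTensor.transferMatrix, hC]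
    exact e.sum_comp fun n => B.mat n ⊗ₖ (B.mat n).map (starRingEnd ℂ)
  have hirr (h : B.IsGradedIrreducible) : C.IsGradedIrreducible := by
    rw [EvenTensor.isGradedIrreducible_iff] at h ⊢
    refine fun W hZ hW => h W (hp ▸ hZ) fun n v hv => ?_
    have := hW (e.symm n) v hv
    rwa [hC, e.apply_symm_apply] at this
  rcases hB with ⟨h1, h2, h3⟩ | ⟨h1, h2, h3⟩
  · exact Or.inl ⟨hirr h1, ht ▸ h2, by rwa [EvenTensor.peripheralEigenvalues, ht]⟩
  · exact Or.inr ⟨hirr h1, ht ▸ h2, by rwa [EvenTensor.peripheralEigenvalues, ht]⟩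

namespace HasCanonicalTraces

variable {σ τ : Type} [Fintype σ] [Fintype τ] {phys : σ → ZMod 2} {phys' : τ → ZMod 2}

theorem congr {f g : ∀ N : ℕ, (Fin N → σ) → ℂ} (hf : HasCanonicalTraces phys f)
    (h : ∀ N, 0 < N → ∀ I, g N I = f N I) : HasCanonicalTraces phys g := by
  obtain ⟨κ, _, D, μ, B, hB, hs⟩ := hf
  exact ⟨κ, _, D, μ, B, hB, fun N hN I => (h N hN I).trans (hs N hN I)⟩

theorem zero : HasCanonicalTraces phys fun _ _ => 0 :=
  ⟨Empty, inferInstance, Empty.elim, Empty.elim, fun k => k.elim, fun k => k.elim, by simp⟩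

theorem add {f g : ∀ N : ℕ, (Fin N → σ) → ℂ} (hf : HasCanonicalTraces phys f)
    (hg : HasCanonicalTraces phys g) : HasCanonicalTraces phys fun N I => f N I + g N I := by
  obtain ⟨κ, _, D, μ, B, hB, hs⟩ := hf
  obtain ⟨κ', _, D', μ', B', hB', hs'⟩ := hg
  refine ⟨κ ⊕ κ', inferInstance, Sum.elim D D', Sum.elim μ μ', Sum.rec B B', ?_, ?_⟩
  · rintro (k | k)
    · exact hB k
    · exact hB' k
  · intro N hN I
    rw [Fintype.sum_sum_type]
    exact congrArg₂ (· + ·) (hs N hN I) (hs' N hN I)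

theorem of_isGNT {D : ℕ} {B : EvenTensor phys (Fin D)} (hB : B.IsGNT) (c : ℂ) :
    HasCanonicalTraces phys fun N I => c ^ N * (wordProd B.mat I).trace :=
  ⟨Unit, inferInstance, fun _ => D, fun _ => c, fun _ => B, fun _ => hB, by simp⟩

theorem comp_equiv {f : ∀ N : ℕ, (Fin N → τ) → ℂ} (hf : HasCanonicalTraces phys' f) (e : σ ≃ τ)
    (he : ∀ n, phys' (e n) = phys n) : HasCanonicalTraces phys fun N I => f N (e ∘ I) := by
  obtain ⟨κ, _, D, μ, B, hB, hs⟩ := hf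
  let C (k : κ) : EvenTensor phys (Fin (D k)) :=
    { mat := fun n => (B k).mat (e n)
      parity := (B k).parity
      even := fun n => by rw [(B k).even, he] }
  exact ⟨κ, _, D, μ, C, fun k => (hB k).comp_equiv e rfl fun _ => rfl,
    fun N hN I => hs N hN (e ∘ I)⟩

end HasCanonicalTraces

/-- Some blocking of every even tensor, and all its further blockings, generate the states of a
weighted sum of graded normal tensors. -/
theorem EvenTensor.exists_hasCanonicalTraces (D : ℕ) :
    ∀ {σ : Type} [Fintype σ] (phys : σ → ZMod 2) (A : EvenTensor phys (Fin D)),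
      ∃ p, 0 < p ∧ ∀ m, 0 < m → p ∣ m →
        HasCanonicalTraces (blockParity phys m) fun _ I => (wordProd (A.block m).mat I).trace := by
  induction D using Nat.strong_induction_on with
  | _ D ih =>
    intro σ _ phys A
    by_cases hirr : ∀ q, 0 < q → (A.block q).IsGradedIrreducible
    · refine ⟨2, two_pos, fun m hm h2 => ?_⟩
      by_cases hA : ∃ n, A.mat n ≠ 0
      · obtain ⟨c, B, hB, hc⟩ := A.exists_isGNT_block hirr hA hm h2
        refine (HasCanonicalTraces.of_isGNT hB c).congr fun N _ I => ?_
        rw [funext hc, wordProd_smul, trace_smul, smul_eq_mul]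
      · push Not at hA
        refine HasCanonicalTraces.zero.congr fun N hN I => ?_
        -- Both N and m must be positive, since the empty word is the identity even when all
        -- matrices vanish.
        obtain ⟨N, rfl⟩ := Nat.exists_eq_succ_of_ne_zero hN.ne'
        obtain ⟨m, rfl⟩ := Nat.exists_eq_succ_of_ne_zero hm.ne'
        have h0 : (A.block (m + 1)).mat (I 0) = 0 := by
          change wordProd A.mat (I 0) = 0
          rw [wordProd_succ, hA, zero_mul]
        rw [wordProd_succ, h0, zero_mul, trace_zero]
    · push Not at hirr
      obtain ⟨q, hq, hred⟩ := hirr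
      obtain ⟨n₁, n₂, B₁, B₂, h₁, h₂, hsplit⟩ := (A.block q).exists_split hred
      rw [Fintype.card_fin] at h₁ h₂
      obtain ⟨p₁, hp₁, hc₁⟩ := ih n₁ h₁ _ B₁
      obtain ⟨p₂, hp₂, hc₂⟩ := ih n₂ h₂ _ B₂
      refine ⟨p₁ * p₂ * q, by positivity, ?_⟩
      rintro _ hm ⟨k, rfl⟩
      -- The multiple k joins the outer length s = p₁p₂k, which both p₁ and p₂ divide, while q
      -- remains the inner block length at which the tensor splits.
      rw [show p₁ * p₂ * q * k = p₁ * p₂ * k * q by ring] at hm ⊢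
      set s := p₁ * p₂ * k with hs
      have hs0 : 0 < s := Nat.pos_of_mul_pos_right hm
      have hsum := ((hc₁ s hs0 ⟨p₂ * k, by rw [hs]; ring⟩).add
        (hc₂ s hs0 ⟨p₁ * k, by rw [hs]; ring⟩)).comp_equiv (blockEquiv σ s q)
          (blockParity_blockEquiv phys)
      refine hsum.congr fun N _ I => ?_
      -- The splitting identity holds for words in q-blocks, so words in s-blocks of these are
      -- flattened before it is applied.
      have hflat {κ : Type} [Fintype κ] [DecidableEq κ]
          (B : EvenTensor (blockParity phys q) κ) :
          wordProd (B.block s).mat (blockEquiv σ s q ∘ I) = wordProd B.mat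
            ((blockEquiv (Fin q → σ) N s).symm (blockEquiv σ s q ∘ I)) := by
        rw [← wordProd_blockEquiv B.mat, Equiv.apply_symm_apply]
        rfl
      rw [hflat, hflat, ← hsplit, ← hflat]
      congr 1
      simp only [wordProd]
      congr 2
      ext j : 1
      exact (wordProd_blockEquiv A.mat (I j)).symm

/-- An even basis vector of the physical space gives a product state that is a graded normal
tensor. -/
theorem exists_isGNT {σ : Type*} [Fintype σ] {phys : σ → ZMod 2} {n₀ : σ} (h : phys n₀ = 0) :
    ∃ B : EvenTensor phys (Fin 1), B.IsGNT := by
  classical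
  have hone : parityOperator (0 : Fin 1 → ZMod 2) = 1 := by
    simp [parityOperator, paritySign_zero]
  let B : EvenTensor phys (Fin 1) :=
    { mat := fun n => if n = n₀ then 1 else 0
      parity := 0
      even := fun n => by
        split_ifs with hn
        · rw [hn, h, paritySign_zero, one_smul, one_mul, mul_one]
        · simp }
  have hch (X : Matrix (Fin 1) (Fin 1) ℂ) : channel B.mat X = X := by
    rw [channel_apply, Finset.sum_eq_single n₀ (fun n _ hn => by simp [B, hn]) (by simp)]
    simp [B]
  refine ⟨B, B.isGNT_of_channel ?_ PosDef.one (by simp) (hch 1) fun z _ hz => ?_⟩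
  · rw [EvenTensor.isGradedIrreducible_iff]
    intro W _ _
    refine or_iff_not_imp_left.2 fun hW => ?_
    obtain ⟨v, hv, hv0⟩ := W.exists_mem_ne_zero_of_ne_bot hW
    have hv1 : v 0 ≠ 0 := fun h0 => hv0 (funext fun i => by rw [Subsingleton.elim i 0, h0]; rfl)
    rw [eq_top_iff]
    intro u _
    have : u = (u 0 / v 0) • v := funext fun i => by
      rw [Subsingleton.elim i 0, Pi.smul_apply, smul_eq_mul, div_mul_cancel₀ _ hv1]
    rw [this]
    exact W.smul_mem _ hv
  · obtain ⟨Y, hY⟩ := hz.exists_hasEigenvector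
    have h1 := hY.apply_eq_smul
    rw [hch] at h1
    refine smul_left_injective ℂ hY.2 ?_
    simpa using h1.symm

/-! ### Assembling the canonical form. -/

section DirectSum

variable {σ : Type*} {phys : σ → ZMod 2} {r : ℕ} {D : Fin r → ℕ}

/-- The direct sum `⨁ₖ μₖ Bₖ` of even tensors. -/
def directSum (μ : Fin r → ℂ) (B : ∀ k, EvenTensor phys (Fin (D k))) :
    EvenTensor phys (Σ k : Fin r, Fin (D k)) where
  mat n := blockDiagonal' fun k => μ k • (B k).mat n
  parity i := (B i.1).parity i.2
  even n := by
    have h : parityOperator (fun i : Σ k : Fin r, Fin (D k) => (B i.1).parity i.2) =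
        blockDiagonal' fun k => parityOperator (B k).parity :=
      (blockDiagonal'_diagonal fun k i => paritySign ((B k).parity i)).symm
    rw [h, ← blockDiagonal'_mul, ← blockDiagonal'_mul, ← blockDiagonal'_smul]
    congr 1
    ext1 k
    rw [mul_smul_comm, (B k).even, Pi.smul_apply, smul_mul_assoc, smul_comm]

theorem directSum_isGradedCanonicalForm [Fintype σ] (μ : Fin r → ℂ)
    (B : ∀ k, EvenTensor phys (Fin (D k))) (hB : ∀ k, (B k).IsGNT) :
    (directSum μ B).IsGradedCanonicalForm :=
  ⟨μ, B, hB, fun _ => rfl,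
    (blockDiagonal'_diagonal fun k i => paritySign ((B k).parity i)).symm⟩

theorem wordProd_directSum (μ : Fin r → ℂ) (B : ∀ k, EvenTensor phys (Fin (D k))) {N : ℕ}
    (I : Fin N → σ) : wordProd (directSum μ B).mat I =
      blockDiagonal' fun k => μ k ^ N • wordProd (B k).mat I := by
  induction N with
  | zero =>
    simp only [wordProd_zero, pow_zero, one_smul]
    exact blockDiagonal'_one.symm
  | succ N ih =>
    rw [wordProd_succ, ih]
    change (blockDiagonal' fun k => μ k • (B k).mat (I 0)) * _ = _
    rw [← blockDiagonal'_mul]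
    congr 1
    ext1 k
    rw [wordProd_succ, smul_mul_smul_comm, pow_succ']

end DirectSum

theorem HasCanonicalTraces.exists_gradedCanonicalForm {σ : Type} [Fintype σ] {phys : σ → ZMod 2}
    {f : ∀ N : ℕ, (Fin N → σ) → ℂ} (hf : HasCanonicalTraces phys f)
    (h : ∃ B : EvenTensor phys (Fin 1), B.IsGNT) :
    ∃ r : ℕ, 0 < r ∧ ∃ (D : Fin r → ℕ) (C : EvenTensor phys (Σ k : Fin r, Fin (D k))),
      C.IsGradedCanonicalForm ∧ ∀ N, 0 < N → ∀ I, (wordProd C.mat I).trace = f N I := by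
  obtain ⟨κ, _, D, μ, B, hB, hs⟩ := hf
  rcases isEmpty_or_nonempty κ with hκ | hκ
  -- An empty sum still needs one block, so a product state with weight 0 is inserted.
  · obtain ⟨B₀, hB₀⟩ := h
    refine ⟨1, one_pos, fun _ => 1, directSum (fun _ => 0) fun _ => B₀,
      directSum_isGradedCanonicalForm _ _ fun _ => hB₀, fun N hN I => ?_⟩
    rw [wordProd_directSum, trace_blockDiagonal', hs N hN]
    simp [hN.ne']
  · let e := Fintype.equivFin κ
    refine ⟨Fintype.card κ, Fintype.card_pos, fun k => D (e.symm k),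
      directSum (fun k => μ (e.symm k)) fun k => B (e.symm k),
      directSum_isGradedCanonicalForm _ _ fun k => hB _, fun N hN I => ?_⟩
    rw [wordProd_directSum, trace_blockDiagonal', hs N hN, ← e.symm.sum_comp]
    simp only [trace_smul, smul_eq_mul]

theorem blockParity_const {σ : Type*} (phys : σ → ZMod 2) (n : σ) (p : ℕ) :
    blockParity phys (2 * p) (fun _ => n) = 0 := by
  rw [blockParity, Finset.sum_const, Finset.card_univ, Fintype.card_fin, mul_comm, mul_nsmul']
  have : 2 • phys n = 0 := by rw [two_nsmul]; exact CharTwo.add_self_eq_zero _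
  rw [this, nsmul_zero]

end FermionicMPS

theorem mainTheorem3 {d D : ℕ} (hd : 0 < d) (phys : Fin d → ZMod 2)
    (A : FermionicMPS.EvenTensor phys (Fin D)) :
    ∃ p : ℕ, 0 < p ∧ ∃ r : ℕ, 0 < r ∧ ∃ D' : Fin r → ℕ,
      ∃ A' : FermionicMPS.EvenTensor (FermionicMPS.blockParity phys p) (Σ k : Fin r, Fin (D' k)),
        A'.IsGradedCanonicalForm ∧
        ∀ N : ℕ, 0 < N → A'.antiperiodicState N = (A.block p).antiperiodicState N := by
  obtain ⟨p, hp, h⟩ := FermionicMPS.EvenTensor.exists_hasCanonicalTraces D phys A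
  obtain ⟨r, hr, D', A', hA', hs⟩ := (h (2 * p) (by omega)
    (dvd_mul_left p 2)).exists_gradedCanonicalForm
      (FermionicMPS.exists_isGNT (FermionicMPS.blockParity_const phys ⟨0, hd⟩ p))
  refine ⟨2 * p, by omega, r, hr, D', A', hA', fun N hN => ?_⟩
  exact congrArg (WithLp.toLp 2) (funext fun I => hs N hN I)
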